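/- Theorem 1. Consider $N\ge 2$ players; player $i$ chooses $x_i\in\mathbb R^{n_i}$, $n=\sum_i n_i$, and has cost $J_i(x_i,x_{-i})$ which, for each fixed $x_{-i}$, is $C^2$, strictly convex and radially unbounded in $x_i$. Let $F(x)=\mathrm{col}(\nabla_1J_1(x),\dots,\nabla_NJ_N(x))$ be $\varepsilon$-strongly monotone, $(x-y)^T(F(x)-F(y))\ge\varepsilon\|x-y\|^2$, and $\iota$-Lipschitz, with $\varepsilon,\iota>0$ (Euclidean norms). Let $\bar{\mathcal G}$ be a strongly connected digraph on the players with weights $\bar a_{ij}>0$ if $i$ receives from $j$ and $\bar a_{ij}=0$ otherwise, with Laplacian $\bar{\mathcal L}$ (diagonal matrix of row sums minus weights); let $\omega$ have positive entries and satisfy $\omega^T\bar{\mathcal L}=0$; put $a_{ij}=\omega_i\bar a_{ij}$, let $\mathcal L$ be the Laplacian of $(a_{ij})$, $\hat{\mathcal L}=\frac12(\mathcal L+\mathcal L^T)$, and let $\lambda_2(\hat{\mathcal L})$ be the smallest positive eigenvalue of $\hat{\mathcal L}$. Let $\kappa>\frac1{\lambda_2(\hat{\mathcal L})}\big(\frac{\iota^2}{\varepsilon}+\iota\big)$.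 Attacks. Each channel $(i,j)$ (over which $i$ receives from $j$) suffers a finite or infinite sequence of attacks, active on $\{a^{ij}_m\}\cup[a^{ij}_m,a^{ij}_m+\tau^{ij}_m)$ with $\tau^{ij}_m\ge0$ and $a^{ij}_{m+1}>a^{ij}_m+\tau^{ij}_m$. Let $\Xi_a$ be the set of times at which some channel is attacked, and $N_a(T_1,T_2)$ the number of passages of the network from "no attack" to "attack" in $[T_1,T_2)$. Measurable flags $\psi(i,j,t)\in\{0,1,-1\}$ are nonzero while channel $(i,j)$ is attacked and $0$ while neither $(i,j)$ nor $(j,i)$ is; put $a^{\Psi(t)}_{ij}=1$ if $i$ receives from $j$ in $\bar{\mathcal G}$ and $\psi(i,j,t)=0$, and $a^{\Psi(t)}_{ij}=0$ otherwise, with Laplacian $\mathcal L^{\Psi(t)}$. Algorithm. Player $i$ keeps an estimate $\mathbf x^i\in\mathbb R^n$ of all actions, with $$\dot{\mathbf x}^i=-\mathcal R_i^T\nabla_iJ_i(\mathbf x^i)+\mathbf e^i,\qquad \mathbf e^i=\begin{cases}-\kappa\sum_j a_{ij}(\mathbf x^i-\mathbf x^j), & t\notin\Xi_a,\\ \sum_j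 a^{\Psi(t)}_{ij}(\mathbf x^j-\mathbf x^i), & t\in\Xi_a,\end{cases}$$ where $\mathcal R_i^T$ embeds $\mathbb R^{n_i}$ as the $i$-th block of $\mathbb R^n$; $\mathbf x=\mathrm{col}(\mathbf x^1,\dots,\mathbf x^N)$. Solutions are continuous functions on $[t_0,\infty)$ satisfying the equation in integral form. Constants. For $c\ge0$ let $$\lambda_a=2\,\lambda_{\min}\begin{pmatrix}\frac{\varepsilon}{N}&-\frac{\iota}{\sqrt N}\\-\frac{\iota}{\sqrt N}&\kappa\lambda_2(\hat{\mathcal L})-\iota\end{pmatrix},\qquad \lambda_b=2\,\sigma_{\max}\begin{pmatrix}c-\frac{\varepsilon}{N}&c+\frac{\iota}{\sqrt N}\\c+\frac{\iota}{\sqrt N}&c+\iota\end{pmatrix}.$$ Then the game has exactly one Nash equilibrium $x^*$, and $\lambda_a,\lambda_b>0$. Let $\mu>1$, $\eta^*\in(0,\lambda_a)$, $T_f>2\ln(\mu)/\eta^*$ and $T_a>(\lambda_a+\lambda_b)/(\lambda_a-\eta^*)$. Then $\eta=\lambda_a-(\lambda_a+\lambda_b)/T_a-\eta^*>0$, and for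 all $N_0>0$, $T_0\ge0$ there is $\varsigma>0$ such that the following holds for every $t_0\ge0$ and all attacks and flags as above which satisfy $N_a(T_1,T_2)\le N_0+(T_2-T_1)/T_f$ and $|\Xi_a\cap[T_1,T_2)|\le T_0+(T_2-T_1)/T_a$ for all $T_2>T_1\ge t_0$, and $\|\mathcal L^{\Psi(t)}\|\le c$ (spectral norm) for all $t\ge t_0$ in $\Xi_a$: the algorithm has a solution from every initial value $\mathbf x(t_0)$, and every solution satisfies, with $\tilde{\mathbf x}=1_N\otimes x^*$, $$\|\mathbf x(t)-\tilde{\mathbf x}\|^2\le\varsigma\,e^{-\eta(t-t_0)}\,\|\mathbf x(t_0)-\tilde{\mathbf x}\|^2,\qquad t\ge t_0.$$ -/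

import Mathlib

namespace ResilientNash

open MeasureTheory Set

/-! ### The game -/

/-- Action profiles `x = col(x₁, …, x_N)` with `xᵢ ∈ ℝ^{dᵢ}`, with the Euclidean norm of `ℝⁿ`,
`n = d₁ + ⋯ + d_N`. -/
abbrev Profile {N : ℕ} (d : Fin N → ℕ) : Type :=
  PiLp 2 (fun i : Fin N => EuclideanSpace ℝ (Fin (d i)))

/-- Stacked estimates `col(x¹, …, x^N) ∈ ℝ^{Nn}`, with the Euclidean norm; `x i j` is the estimate
that player `i` has of the action of player `j`. -/
abbrev Estimates {N : ℕ} (d : Fin N → ℕ) : Type :=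
  PiLp 2 (fun _ : Fin N => Profile d)

variable {N : ℕ} {d : Fin N → ℕ}

/-- The profile `(y, x_{-i})`: the action of player `i` in `x` is replaced by `y`. -/
noncomputable def replace (x : Profile d) (i : Fin N) (y : EuclideanSpace ℝ (Fin (d i))) :
    Profile d :=
  WithLp.toLp 2 (Function.update x.ofLp i y)

/-- `x` is a Nash equilibrium of the game with costs `J`. -/
def IsNash (J : Fin N → Profile d → ℝ) (x : Profile d) : Prop :=
  ∀ (i : Fin N) (y : EuclideanSpace ℝ (Fin (d i))), J i x ≤ J i (replace x i y)

/-- Each `J i` is `C²`, strictly convex and radially unbounded in the action of player `i`,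
for every choice of the actions of the other players. -/
def CostAssumption (J : Fin N → Profile d → ℝ) : Prop :=
  ∀ (i : Fin N) (x : Profile d),
    ContDiff ℝ 2 (fun y => J i (replace x i y)) ∧
    StrictConvexOn ℝ univ (fun y => J i (replace x i y)) ∧
    Filter.Tendsto (fun y => J i (replace x i y)) (Filter.cocompact _) Filter.atTop

/-- The partial gradient `∇ᵢ Jᵢ (xᵢ, x_{-i})` with respect to the player's own action. -/
noncomputable def partialGrad (J : Fin N → Profile d → ℝ) (i : Fin N) (x : Profile d) :
    EuclideanSpace ℝ (Fin (d i)) :=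
  gradient (fun y => J i (replace x i y)) (x i)

/-- The pseudo-gradient `F(x) = col(∇₁J₁(x), …, ∇_N J_N(x))`. -/
noncomputable def pseudoGrad (J : Fin N → Profile d → ℝ) (x : Profile d) : Profile d :=
  WithLp.toLp 2 (fun i => partialGrad J i x)

/-- `F` is `ε`-strongly monotone. -/
def StronglyMonotone (ε : ℝ) (F : Profile d → Profile d) : Prop :=
  ∀ x y : Profile d, ε * ‖x - y‖ ^ 2 ≤ inner ℝ (x - y) (F x - F y)

/-- `F` is `ι`-Lipschitz. -/
def IsLipschitz (ι : ℝ) (F : Profile d → Profile d) : Prop :=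
  ∀ x y : Profile d, ‖F x - F y‖ ≤ ι * ‖x - y‖

/-! ### The communication graph -/

/-- Every ordered pair of nodes is joined by a directed path. -/
def StronglyConnected (G : Digraph (Fin N)) : Prop :=
  ∀ i j : Fin N, Relation.ReflTransGen G.Adj i j

/-- `A` is a weighted adjacency matrix of `G`: `A i j > 0` if `(j, i)` is an edge (player `i`
receives information from player `j`), and `A i j = 0` otherwise. -/
def IsAdjacencyMatrix (G : Digraph (Fin N)) (A : Matrix (Fin N) (Fin N) ℝ) : Prop :=
  ∀ i j : Fin N, (G.Adj j i → 0 < A i j) ∧ (¬ G.Adj j i → A i j = 0)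

/-- The Laplacian `D - A`, with `D` the diagonal matrix of the row sums of `A`. -/
def laplacian (A : Matrix (Fin N) (Fin N) ℝ) : Matrix (Fin N) (Fin N) ℝ :=
  Matrix.diagonal (fun i => ∑ j, A i j) - A

/-- The rescaled weights `a i j = ω i * Abar i j`. -/
def scaledWeights (ω : Fin N → ℝ) (Abar : Matrix (Fin N) (Fin N) ℝ) :
    Matrix (Fin N) (Fin N) ℝ :=
  Matrix.of (fun i j => ω i * Abar i j)

/-- The symmetric part `(L + Lᵀ) / 2`. -/
noncomputable def symPart (L : Matrix (Fin N) (Fin N) ℝ) : Matrix (Fin N) (Fin N) ℝ :=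
  (1 / 2 : ℝ) • (L + L.transpose)

/-- The smallest positive eigenvalue of a real matrix. -/
noncomputable def minPosEigenvalue {m : ℕ} (M : Matrix (Fin m) (Fin m) ℝ) : ℝ :=
  sInf {l : ℝ | 0 < l ∧ Module.End.HasEigenvalue (Matrix.toLin' M) l}

/-- The smallest real eigenvalue of a real matrix. -/
noncomputable def minEigenvalue {m : ℕ} (M : Matrix (Fin m) (Fin m) ℝ) : ℝ :=
  sInf {l : ℝ | Module.End.HasEigenvalue (Matrix.toLin' M) l}

/-- The spectral norm (largest singular value) of a real matrix. -/
noncomputable def specNorm {m : ℕ} (M : Matrix (Fin m) (Fin m) ℝ) : ℝ :=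
  ‖Matrix.toEuclideanCLM (n := Fin m) (𝕜 := ℝ) M‖

/-! ### Denial-of-service attacks -/

/-- A DoS attack signal. The channel `(i, j)`, over which player `i` receives from player `j`,
suffers a finite or infinite number `count i j` of attacks; the `m`-th one starts at `onset i j m`
and lasts `duration i j m`, and each one ends before the next one starts. -/
structure DoSAttack (N : ℕ) where
  count : Fin N → Fin N → ℕ∞
  onset : Fin N → Fin N → ℕ → ℝ
  duration : Fin N → Fin N → ℕ → ℝ
  duration_nonneg : ∀ i j m, 0 ≤ duration i j m
  separated : ∀ i j (m : ℕ), ((m + 1 : ℕ) : ℕ∞) < count i j →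
    onset i j m + duration i j m < onset i j (m + 1)

/-- The times at which the channel `(i, j)` of `G` is attacked: the union of the sets
`{a_m} ∪ [a_m, a_m + τ_m)`. -/
def DoSAttack.channel (A : DoSAttack N) (G : Digraph (Fin N)) (i j : Fin N) : Set ℝ :=
  {t | G.Adj j i ∧ ∃ m : ℕ, (m : ℕ∞) < A.count i j ∧
    t ∈ {A.onset i j m} ∪ Ico (A.onset i j m) (A.onset i j m + A.duration i j m)}

/-- The times at which some channel is attacked. -/
def DoSAttack.active (A : DoSAttack N) (G : Digraph (Fin N)) : Set ℝ :=
  ⋃ (i : Fin N) (j : Fin N), A.channel G i j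

/-- The instants at which the network passes from "no attack" to "under attack", i.e. the left
end points of the maximal intervals of attack. -/
def DoSAttack.starts (A : DoSAttack N) (G : Digraph (Fin N)) : Set ℝ :=
  {s | s ∈ A.active G ∧ ¬ ∃ δ > 0, Ioo (s - δ) s ⊆ A.active G}

/-- Attack frequency: the number of attacks that start in `[T₁, T₂)` is at most
`N₀ + (T₂ - T₁) / T_f`. -/
def DoSAttack.FrequencyBound (A : DoSAttack N) (G : Digraph (Fin N)) (t₀ N₀ Tf : ℝ) : Prop :=
  ∀ T₁ T₂ : ℝ, t₀ ≤ T₁ → T₁ < T₂ →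
    (A.starts G ∩ Ico T₁ T₂).Finite ∧
    ((A.starts G ∩ Ico T₁ T₂).ncard : ℝ) ≤ N₀ + (T₂ - T₁) / Tf

/-- Attack duration: the total time under attack in `[T₁, T₂)` is at most
`T₀ + (T₂ - T₁) / T_a`. -/
def DoSAttack.DurationBound (A : DoSAttack N) (G : Digraph (Fin N)) (t₀ T₀ Ta : ℝ) : Prop :=
  ∀ T₁ T₂ : ℝ, t₀ ≤ T₁ → T₁ < T₂ →
    volume.real (A.active G ∩ Ico T₁ T₂) ≤ T₀ + (T₂ - T₁) / Ta

/-- `ψ` is an attack flag for the attack signal: it takes the values `0`, `1`, `-1`; it is nonzero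
on `(i, j)` while that channel is attacked, and zero while neither that channel nor the reverse
channel is attacked. While only the reverse channel is attacked, player `i` may have learned of it
(flag `-1`) or not (flag `0`). -/
structure IsAttackFlag (A : DoSAttack N) (G : Digraph (Fin N)) (ψ : Fin N → Fin N → ℝ → ℤ) :
    Prop where
  measurable : ∀ i j, Measurable (ψ i j)
  range : ∀ i j t, ψ i j t = 0 ∨ ψ i j t = 1 ∨ ψ i j t = -1
  attacked : ∀ i j t, t ∈ A.channel G i j → ψ i j t ≠ 0
  free : ∀ i j t, t ∉ A.channel G i j → t ∉ A.channel G j i → ψ i j t = 0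

open Classical in
/-- The adjacency matrix of the graph that remains at time `t`: the entry `(i, j)` is `1` if
`(j, i)` is an edge with flag `ψ i j t = 0`, and `0` otherwise. -/
noncomputable def attackedWeights (G : Digraph (Fin N)) (ψ : Fin N → Fin N → ℝ → ℤ) (t : ℝ) :
    Matrix (Fin N) (Fin N) ℝ :=
  Matrix.of (fun i j => if G.Adj j i ∧ ψ i j t = 0 then 1 else 0)

/-! ### The algorithm -/

open Classical in
/-- The consensus term `eⁱ`: `-κ ∑ⱼ aᵢⱼ (xⁱ - xʲ)` in the absence of attacks, and
`∑ⱼ a^Ψᵢⱼ(t) (xʲ - xⁱ)` while some channel is attacked. -/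
noncomputable def consensusTerm (κ : ℝ) (a : Matrix (Fin N) (Fin N) ℝ) (G : Digraph (Fin N))
    (A : DoSAttack N) (ψ : Fin N → Fin N → ℝ → ℤ) (t : ℝ) (x : Estimates d) (i : Fin N) :
    Profile d :=
  if t ∈ A.active G then ∑ j, attackedWeights G ψ t i j • (x j - x i)
  else (-κ) • ∑ j, a i j • (x i - x j)

/-- The right-hand side of the algorithm: `ẋⁱ = -Rᵢᵀ ∇ᵢJᵢ(xⁱ) + eⁱ`, where `Rᵢᵀ` puts a vector of
`ℝ^{dᵢ}` into the block `i` of a profile. -/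
noncomputable def algorithmField (J : Fin N → Profile d → ℝ) (κ : ℝ)
    (a : Matrix (Fin N) (Fin N) ℝ) (G : Digraph (Fin N)) (A : DoSAttack N)
    (ψ : Fin N → Fin N → ℝ → ℤ) (t : ℝ) (x : Estimates d) : Estimates d :=
  WithLp.toLp 2 (fun i =>
    -(PiLp.single 2 i (partialGrad J i (x i)) : Profile d) + consensusTerm κ a G A ψ t x i)

/-- `x` is a (Carathéodory) solution on `[t₀, ∞)` of `ẋ = f(t, x)`, whose right-hand side is
discontinuous in time. -/
def IsSolution (f : ℝ → Estimates d → Estimates d) (t₀ : ℝ) (x : ℝ → Estimates d) : Prop :=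
  ContinuousOn x (Ici t₀) ∧
  ∀ t, t₀ ≤ t → IntervalIntegrable (fun s => f s (x s)) volume t₀ t ∧
    x t = x t₀ + ∫ s in t₀..t, f s (x s)

/-- The stacked vector `1_N ⊗ x`. -/
noncomputable def stackedCopy (x : Profile d) : Estimates d :=
  WithLp.toLp 2 (fun _ => x)

/-! ### The rates -/

/-- The decay rate `λ_a = λ_min(Q_a) / λ_max(P_a)` in the absence of attacks, where
`P_a = α I` and `Q_a = 2 α [[ε/N, -ι/√N], [-ι/√N, κ λ₂ - ι]]`; it does not depend on `α > 0`. -/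
noncomputable def decayRate (N : ℕ) (ε ι κ l₂ : ℝ) : ℝ :=
  minEigenvalue ((2 : ℝ) • !![ε / N, -(ι / √N); -(ι / √N), κ * l₂ - ι])

/-- The growth rate `λ_b = σ_max(Q_b) / λ_min(P_b)` under attacks, where `P_b = β I` and
`Q_b = 2 β [[c - ε/N, c + ι/√N], [c + ι/√N, c + ι]]`; it does not depend on `β > 0`. The number `c`
bounds the spectral norm of the Laplacian under attacks. -/
noncomputable def growthRate (N : ℕ) (ε ι c : ℝ) : ℝ :=
  specNorm ((2 : ℝ) • !![c - ε / N, c + ι / √N; c + ι / √N, c + ι])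

end ResilientNash

open ResilientNash

/-! Convexity turns Nash equilibria into zeros of `pseudoGrad J`, and a strongly monotone Lipschitz
map has exactly one zero `xs`. The Lyapunov function is V = ‖e‖² with e = x - 1⊗`xs`. Split e into
its average m and the disagreement w, so that V = N‖m‖² + ‖w‖². Comparing the players' gradients
with F at the common point `xs` + m shows that the gradient part of the field pairs with e to at
most -ε‖m‖² + 2ι‖m‖‖w‖ + ι‖w‖² (`le_inner_ownBlocks_extendedGrad`). Without attack, the rescaled
weights are balanced, so the consensus part acts on w alone and contributes at most -κλ₂‖w‖²
(`minPosEigenvalue_laplacian`). The sum is a negative definite form in (√N‖m‖, ‖w‖), whence V' ≤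
-λ_a V. Under attack the consensus part is only bounded by c‖e‖², whence V' ≤ λ_b V. The same V
serves both modes, so no factor is lost at a switch. A Grönwall inequality with integrable rate
(`norm_sq_le_exp_integral_mul`) gives the exponent -λ_a(t - t₀) + (λ_a + λ_b)·(time under attack),
and the duration bound finishes the estimate. Solutions exist because the field is measurable in
time and uniformly Lipschitz in space. -/

namespace ResilientNash

open MeasureTheory Set

/-! ### Absolute continuity and a Grönwall inequality with integrable rate -/

theorem absolutelyContinuousOnInterval_of_dist_le {X Y : Type*} [PseudoMetricSpace X]
    [PseudoMetricSpace Y] {f : ℝ → X} {g : ℝ → Y} {a b K : ℝ}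
    (hg : AbsolutelyContinuousOnInterval g a b)
    (h : ∀ x ∈ uIcc a b, ∀ y ∈ uIcc a b, dist (f x) (f y) ≤ K * dist (g x) (g y)) :
    AbsolutelyContinuousOnInterval f a b := by
  have hg' := Filter.Tendsto.const_mul K hg
  rw [mul_zero] at hg'
  refine squeeze_zero' (Filter.Eventually.of_forall fun E => Finset.sum_nonneg fun i _ =>
    dist_nonneg) ?_ hg'
  refine Filter.Eventually.filter_mono inf_le_right ?_
  rw [Filter.eventually_principal]
  intro E hE
  rw [Finset.mul_sum]
  exact Finset.sum_le_sum fun i hi => h _ (hE.1 i hi).1 _ (hE.1 i hi).2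

section AbsoluteContinuity

variable {E : Type*} [NormedAddCommGroup E]

theorem absolutelyContinuousOnInterval_norm_sq {x : ℝ → E} {a b : ℝ}
    (hx : AbsolutelyContinuousOnInterval x a b) :
    AbsolutelyContinuousOnInterval (fun t => ‖x t‖ ^ 2) a b := by
  obtain ⟨C, hC⟩ := hx.exists_bound
  refine absolutelyContinuousOnInterval_of_dist_le (K := 2 * C) hx fun s hs t ht => ?_
  rw [Real.dist_eq, dist_eq_norm,
    show ‖x s‖ ^ 2 - ‖x t‖ ^ 2 = (‖x s‖ + ‖x t‖) * (‖x s‖ - ‖x t‖) by ring, abs_mul]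
  have h1 := hC s hs
  have h2 := hC t ht
  refine mul_le_mul ?_ (abs_norm_sub_norm_le _ _) (abs_nonneg _) ?_
  · rw [abs_of_nonneg (by positivity)]; linarith
  · linarith [norm_nonneg (x s)]

theorem absolutelyContinuousOnInterval_exp {g : ℝ → ℝ} {a b : ℝ}
    (hg : AbsolutelyContinuousOnInterval g a b) :
    AbsolutelyContinuousOnInterval (fun t => Real.exp (g t)) a b := by
  obtain ⟨C, hC⟩ := hg.exists_bound
  obtain ⟨K, hK⟩ := (Real.contDiff_exp (n := 1)).contDiffOn.exists_lipschitzOnWith (by decide)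
    (convex_Icc (-C) C) isCompact_Icc
  refine absolutelyContinuousOnInterval_of_dist_le (K := K) hg fun s hs t ht => ?_
  exact hK.dist_le_mul _ (abs_le.1 (hC s hs)) _ (abs_le.1 (hC t ht))

variable [InnerProductSpace ℝ E]

/-- Increments of the vector primitive are dominated by those of the real primitive of `‖f‖`. -/
theorem absolutelyContinuousOnInterval_primitive {f : ℝ → E} {a b : ℝ}
    (hf : IntervalIntegrable f volume a b) :
    AbsolutelyContinuousOnInterval (fun t => ∫ s in a..t, f s) a b := by
  refine absolutelyContinuousOnInterval_of_dist_le (K := 1)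
    (hf.norm.absolutelyContinuousOnInterval_intervalIntegral (c := a) left_mem_uIcc)
    fun s hs t ht => ?_
  have hi : ∀ r ∈ uIcc a b, IntervalIntegrable f volume a r := fun r hr =>
    hf.mono_set (uIcc_subset_uIcc_left hr)
  rw [dist_eq_norm, dist_eq_norm, intervalIntegral.integral_interval_sub_left (hi s hs) (hi t ht),
    intervalIntegral.integral_interval_sub_left (hi s hs).norm (hi t ht).norm, one_mul,
    Real.norm_eq_abs]
  exact intervalIntegral.norm_integral_le_abs_integral_norm

/-- The product of `‖x t‖ ^ 2` and `exp (-∫ g)` is absolutely continuous with a.e. nonpositive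
derivative, so it does not increase. No continuity of `f` or `g` is needed, which allows for
switching. -/
theorem norm_sq_le_exp_integral_mul [CompleteSpace E] {x f : ℝ → E} {g : ℝ → ℝ} {a b : ℝ} (hab : a ≤ b)
    (hf : IntervalIntegrable f volume a b)
    (hx : ∀ t ∈ Icc a b, x t = x a + ∫ s in a..t, f s)
    (hg : IntervalIntegrable g volume a b)
    (h : ∀ t ∈ Icc a b, 2 * inner ℝ (x t) (f t) ≤ g t * ‖x t‖ ^ 2) :
    ‖x b‖ ^ 2 ≤ Real.exp (∫ s in a..b, g s) * ‖x a‖ ^ 2 := by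
  have hxac : AbsolutelyContinuousOnInterval x a b := by
    refine absolutelyContinuousOnInterval_of_dist_le (K := 1)
      (absolutelyContinuousOnInterval_primitive hf) fun s hs t ht => ?_
    rw [uIcc_of_le hab] at hs ht
    rw [hx s hs, hx t ht, dist_add_left, one_mul]
  have hV := absolutelyContinuousOnInterval_norm_sq hxac
  have hGac : AbsolutelyContinuousOnInterval (fun t => ∫ s in a..t, g s) a b :=
    hg.absolutelyContinuousOnInterval_intervalIntegral left_mem_uIcc
  have hW : AbsolutelyContinuousOnInterval
      (fun t => ‖x t‖ ^ 2 * Real.exp (-∫ s in a..t, g s)) a b :=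
    hV.fun_mul (absolutelyContinuousOnInterval_exp hGac.neg)
  have hle : ∀ᵐ t ∂volume, t ∈ Ioc a b →
      deriv (fun t => ‖x t‖ ^ 2 * Real.exp (-∫ s in a..t, g s)) t ≤ 0 := by
    -- The formula for `x` holds only on `[a, b]`, so differentiating it needs an interior point.
    have hb : ∀ᵐ t : ℝ, t ≠ b := by simp [ae_iff, measure_singleton]
    filter_upwards [hf.ae_hasDerivAt_integral, hg.ae_hasDerivAt_integral, hb] with t h1 h2 h3 ht
    have htm : t ∈ uIcc a b := by rw [uIcc_of_le hab]; exact ⟨ht.1.le, ht.2⟩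
    have h1' := h1 htm a left_mem_uIcc
    have h2' := h2 htm a left_mem_uIcc
    have hto : Ioo a b ∈ nhds t := isOpen_Ioo.mem_nhds ⟨ht.1, lt_of_le_of_ne ht.2 h3⟩
    have hxd : HasDerivAt x (f t) t := by
      refine (h1'.const_add (x a)).congr_of_eventuallyEq ?_
      filter_upwards [hto] with s hs using hx s ⟨hs.1.le, hs.2.le⟩
    have hd := hxd.norm_sq.mul h2'.neg.exp
    rw [show deriv (fun t => ‖x t‖ ^ 2 * Real.exp (-∫ s in a..t, g s)) t = _ from hd.deriv]
    have := h t ⟨ht.1.le, ht.2⟩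
    have he := Real.exp_pos (-∫ s in a..t, g s)
    simp only [Pi.neg_apply]
    nlinarith
  have hint := hW.integral_deriv_eq_sub
  have hnonpos : ∫ t in a..b, deriv (fun t => ‖x t‖ ^ 2 * Real.exp (-∫ s in a..t, g s)) t ≤ 0 := by
    rw [intervalIntegral.integral_of_le hab]
    exact setIntegral_nonpos_of_ae_restrict ((ae_restrict_iff' measurableSet_Ioc).2 hle)
  rw [hint] at hnonpos
  simp only [intervalIntegral.integral_same, neg_zero, Real.exp_zero, mul_one] at hnonpos
  rw [Real.exp_neg, ← div_eq_mul_inv, sub_nonpos, div_le_iff₀ (Real.exp_pos _)] at hnonpos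
  linarith

end AbsoluteContinuity

/-! ### Global Carathéodory solutions -/

/-- The weight cancels the exponential growth and leaves the gain 1/L. This gives both the
boundedness and the contraction of the Picard operator. -/
theorem norm_exp_smul_integral_le {F : Type*} [NormedAddCommGroup F] [NormedSpace ℝ F]
    {h : ℝ → F} {C L a b : ℝ} (hL : 0 < L) (hab : a ≤ b)
    (hC : ∀ s ∈ Ioc a b, ‖h s‖ ≤ C * Real.exp (L * (s - a))) (hC0 : 0 ≤ C) :
    ‖Real.exp (-(L * (b - a))) • ∫ s in a..b, h s‖ ≤ C / L := by
  have hd : ∀ t : ℝ, HasDerivAt (fun s => C / L * Real.exp (L * (s - a)))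
      (C * Real.exp (L * (t - a))) t := fun t => by
    have := ((((hasDerivAt_id t).sub_const a).const_mul L).exp).const_mul (C / L)
    refine this.congr_deriv ?_
    simp only [id_eq]
    field_simp
  have hcont : Continuous fun s => C * Real.exp (L * (s - a)) := by fun_prop
  have hint : ‖∫ s in a..b, h s‖ ≤ C / L * Real.exp (L * (b - a)) := by
    have h1 := intervalIntegral.norm_integral_le_of_norm_le (μ := volume) hab
      (Filter.Eventually.of_forall hC) (hcont.intervalIntegrable a b)
    rw [intervalIntegral.integral_eq_sub_of_hasDerivAt (fun t _ => hd t)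
      (hcont.intervalIntegrable a b)] at h1
    have : 0 ≤ C / L * Real.exp (L * (a - a)) := by positivity
    linarith
  rw [norm_smul, Real.norm_eq_abs, Real.abs_exp, Real.exp_neg, inv_mul_le_iff₀ (Real.exp_pos _),
    mul_comm]
  exact hint

/-- Global existence of Carathéodory solutions for a field that is measurable in time and uniformly
Lipschitz in space: the Picard operator is a contraction for an exponentially weighted norm. -/
theorem exists_caratheodory_solution {F : Type*} [NormedAddCommGroup F] [NormedSpace ℝ F]
    [CompleteSpace F] [SecondCountableTopology F] [MeasurableSpace F] [BorelSpace F]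
    (f : ℝ → F → F) (hmeas : ∀ x, Measurable fun t => f t x) {K M : ℝ} (hK : 0 ≤ K)
    (hlip : ∀ t x y, ‖f t x - f t y‖ ≤ K * ‖x - y‖) (hM : ∀ t, ‖f t 0‖ ≤ M) (t₀ : ℝ) (x₀ : F) :
    ∃ x : ℝ → F, Continuous x ∧ x t₀ = x₀ ∧ ∀ t, t₀ ≤ t →
      IntervalIntegrable (fun s => f s (x s)) volume t₀ t ∧
      x t = x₀ + ∫ s in t₀..t, f s (x s) := by
  have hM0 : 0 ≤ M := (norm_nonneg _).trans (hM 0)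
  -- Any rate above `K` makes the contraction constant `K / L` less than 1.
  set L : ℝ := K + 1 with hLdef
  have hL : 0 < L := by positivity
  have hfc : ∀ t, Continuous (f t) := fun t =>
    (LipschitzWith.of_dist_le_mul (K := K.toNNReal) fun x y => by
      simpa [dist_eq_norm, hK] using hlip t x y).continuous
  have hgrow : ∀ t x, ‖f t x‖ ≤ M + K * ‖x‖ := fun t x => by
    have h1 := hlip t x 0
    have h2 := norm_le_norm_add_norm_sub' (f t x) (f t 0)
    rw [sub_zero] at h1
    linarith [hM t]
  have hjoint : Measurable fun p : F × ℝ => f p.2 p.1 :=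
    measurable_uncurry_of_continuous_of_measurable (u := fun x t => f t x) hfc hmeas
  have hint : ∀ (x : ℝ → F), Continuous x → ∀ a b,
      IntervalIntegrable (fun s => f s (x s)) volume a b := fun x hx a b => by
    refine IntervalIntegrable.mono_fun'
      (Continuous.intervalIntegrable (u := fun s => M + K * ‖x s‖) (by fun_prop) a b) ?_
      (Filter.Eventually.of_forall fun s => hgrow s (x s))
    exact (hjoint.comp (hx.measurable.prodMk measurable_id)).aestronglyMeasurable
  -- The unknown is the bounded function `u`; the curve itself is `w u`, which may grow like `exp (L
  -- * (s - t₀))`.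
  let w : (BoundedContinuousFunction ℝ F) → ℝ → F := fun u s => Real.exp (L * (s - t₀)) • u s
  have hw : ∀ u, Continuous (w u) := fun u => by
    have := u.continuous
    fun_prop
  have hwn : ∀ u s, ‖w u s‖ ≤ ‖u‖ * Real.exp (L * (s - t₀)) := fun u s => by
    rw [norm_smul, Real.norm_eq_abs, Real.abs_exp, mul_comm]
    gcongr
    exact u.norm_coe_le_norm s
  let P : (BoundedContinuousFunction ℝ F) → ℝ → F := fun u t =>
    Real.exp (-(L * (t - t₀))) • (x₀ + ∫ s in t₀..t, f s (w u s))
  have hPc : ∀ u, Continuous (P u) := fun u => by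
    have := intervalIntegral.continuous_primitive (μ := volume) (hint (w u) (hw u)) t₀
    fun_prop
  have hPb : ∀ u t, t₀ ≤ t → ‖P u t‖ ≤ ‖x₀‖ + (M + K * ‖u‖) / L := fun u t ht => by
    simp only [P]
    rw [smul_add]
    refine (norm_add_le _ _).trans (add_le_add ?_ ?_)
    · rw [norm_smul, Real.norm_eq_abs, Real.abs_exp]
      refine mul_le_of_le_one_left (norm_nonneg _) (Real.exp_le_one_iff.2 ?_)
      have : 0 ≤ t - t₀ := sub_nonneg.2 ht
      have := mul_nonneg hL.le this
      linarith
    · refine norm_exp_smul_integral_le hL ht (fun s hs => (hgrow _ _).trans ?_) (by positivity)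
      have h1 : 1 ≤ Real.exp (L * (s - t₀)) :=
        Real.one_le_exp (mul_nonneg hL.le (sub_nonneg.2 hs.1.le))
      have h2 := mul_le_mul_of_nonneg_left (hwn u s) hK
      nlinarith
  -- `P u` is bounded only to the right of `t₀`; evaluation at `max t t₀` makes it bounded on the
  -- whole line.
  let T : (BoundedContinuousFunction ℝ F) → (BoundedContinuousFunction ℝ F) := fun u =>
    BoundedContinuousFunction.ofNormedAddCommGroup (fun t => P u (max t t₀))
      ((hPc u).comp (continuous_id.max continuous_const)) _ fun t => hPb u _ (le_max_right _ _)
  have hKL : 0 ≤ K / L := by positivity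
  have hT : ContractingWith (K / L).toNNReal T := by
    refine ⟨?_, LipschitzWith.of_dist_le_mul fun u v => ?_⟩
    · rw [Real.toNNReal_lt_one, div_lt_one hL]
      linarith
    · rw [Real.coe_toNNReal _ hKL, BoundedContinuousFunction.dist_le (by positivity)]
      intro t
      set τ := max t t₀
      have hτ : t₀ ≤ τ := le_max_right _ _
      have h1 : T u t - T v t = Real.exp (-(L * (τ - t₀))) •
          ∫ s in t₀..τ, (f s (w u s) - f s (w v s)) := by
        rw [intervalIntegral.integral_sub (hint _ (hw u) _ _) (hint _ (hw v) _ _)]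
        change P u τ - P v τ = _
        simp only [P]
        rw [← smul_sub, add_sub_add_left_eq_sub]
      rw [dist_eq_norm, h1]
      have h2 := norm_exp_smul_integral_le (h := fun s => f s (w u s) - f s (w v s))
        (C := K * dist u v) hL hτ (fun s _ => ?_) (by positivity)
      · refine h2.trans (le_of_eq ?_)
        ring
      · refine (hlip s _ _).trans ?_
        rw [mul_assoc]
        gcongr
        rw [← smul_sub, norm_smul, Real.norm_eq_abs, Real.abs_exp, mul_comm, ← dist_eq_norm]
        gcongr
        exact BoundedContinuousFunction.dist_coe_le_dist s
  obtain ⟨u, hu⟩ : ∃ u, T u = u := ⟨_, hT.fixedPoint_isFixedPt⟩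
  have key : ∀ t, t₀ ≤ t → w u t = x₀ + ∫ s in t₀..t, f s (w u s) := fun t ht => by
    have h1 : u t = P u t := by
      conv_lhs => rw [← hu]
      change P u (max t t₀) = _
      rw [max_eq_left ht]
    change Real.exp (L * (t - t₀)) • u t = _
    rw [h1]
    simp only [P]
    rw [smul_smul, ← Real.exp_add, add_neg_cancel, Real.exp_zero, one_smul]
  refine ⟨w u, hw u, ?_, fun t ht => ⟨hint _ (hw u) _ _, key t ht⟩⟩
  simpa using key t₀ le_rfl

variable {N : ℕ} {d : Fin N → ℕ}

/-! ### Quadratic forms and extreme eigenvalues of real matrices -/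

open Matrix in
-- The spectral theorem in coordinates, with an orthonormal eigenbasis `b`. Finiteness of `range l`
-- turns the infima over eigenvalues into minima whenever the set is nonempty.
theorem exists_spectral_decomposition {m : ℕ} {M : Matrix (Fin m) (Fin m) ℝ} (hM : M.IsSymm) :
    ∃ (l : Fin m → ℝ) (b : Fin m → Fin m → ℝ), (∀ i, M *ᵥ b i = l i • b i) ∧
      {r : ℝ | Module.End.HasEigenvalue (Matrix.toLin' M) r} = range l ∧
      (∀ x : Fin m → ℝ, x ⬝ᵥ x = ∑ i, (b i ⬝ᵥ x) ^ 2) ∧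
      ∀ x : Fin m → ℝ, x ⬝ᵥ M *ᵥ x = ∑ i, l i * (b i ⬝ᵥ x) ^ 2 := by
  have hH : M.IsHermitian := by
    rw [Matrix.IsHermitian, Matrix.conjTranspose_eq_transpose_of_trivial]; exact hM
  have hpol : ∀ x y : Fin m → ℝ, x ⬝ᵥ y =
      ∑ i, ((hH.eigenvectorBasis i).ofLp ⬝ᵥ x) * ((hH.eigenvectorBasis i).ofLp ⬝ᵥ y) := by
    intro x y
    have h := hH.eigenvectorBasis.sum_inner_mul_inner (WithLp.toLp 2 x) (WithLp.toLp 2 y)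
    simp only [EuclideanSpace.inner_eq_star_dotProduct, star_trivial] at h
    rw [dotProduct_comm, ← h]
    refine Finset.sum_congr rfl fun i _ => ?_
    rw [dotProduct_comm y]
  have hev : ∀ i, M *ᵥ (hH.eigenvectorBasis i).ofLp =
      hH.eigenvalues i • (hH.eigenvectorBasis i).ofLp := fun i => hH.mulVec_eigenvectorBasis i
  refine ⟨hH.eigenvalues, fun i => (hH.eigenvectorBasis i).ofLp, hev, ?_, ?_, ?_⟩
  · rw [← hH.spectrum_real_eq_range_eigenvalues]
    ext r
    rw [mem_ofPred_eq, Module.End.hasEigenvalue_iff_mem_spectrum, Matrix.spectrum_toLin']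
  · intro x
    rw [hpol x x]
    exact Finset.sum_congr rfl fun i _ => (sq _).symm
  · intro x
    rw [hpol x]
    refine Finset.sum_congr rfl fun i _ => ?_
    rw [dotProduct_mulVec _ M x, ← mulVec_transpose, hM.eq, hev i, smul_dotProduct, smul_eq_mul]
    ring

open Matrix in
theorem minEigenvalue_mul_le {m : ℕ} {M : Matrix (Fin m) (Fin m) ℝ} (hM : M.IsSymm)
    (x : Fin m → ℝ) : minEigenvalue M * (x ⬝ᵥ x) ≤ x ⬝ᵥ M *ᵥ x := by
  obtain ⟨l, b, -, hl, hx, hq⟩ := exists_spectral_decomposition hM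
  rw [hx, hq, Finset.mul_sum]
  refine Finset.sum_le_sum fun i _ => mul_le_mul_of_nonneg_right ?_ (sq_nonneg _)
  unfold minEigenvalue
  rw [hl]
  exact csInf_le (finite_range l).bddBelow (mem_range_self i)

open Matrix in
theorem minEigenvalue_pos {m : ℕ} [NeZero m] {M : Matrix (Fin m) (Fin m) ℝ} (hM : M.IsSymm)
    (hpos : ∀ x : Fin m → ℝ, x ≠ 0 → 0 < x ⬝ᵥ M *ᵥ x) : 0 < minEigenvalue M := by
  obtain ⟨l, b, -, hl, -, -⟩ := exists_spectral_decomposition hM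
  have hmem : minEigenvalue M ∈ {r : ℝ | Module.End.HasEigenvalue (Matrix.toLin' M) r} := by
    unfold minEigenvalue
    rw [hl]
    exact (range_nonempty l).csInf_mem (finite_range l)
  obtain ⟨v, hv⟩ := Module.End.HasEigenvalue.exists_hasEigenvector hmem
  have h1 := hpos v hv.2
  have h2 : M *ᵥ v = minEigenvalue M • v := by
    have := hv.apply_eq_smul
    rwa [Matrix.toLin'_apply] at this
  rw [h2, dotProduct_smul, smul_eq_mul] at h1
  exact pos_of_mul_pos_left h1 (Finset.sum_nonneg fun i _ => mul_self_nonneg (v i))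

open Matrix in
theorem abs_dotProduct_mulVec_le {m : ℕ} (M : Matrix (Fin m) (Fin m) ℝ) (x : Fin m → ℝ) :
    |x ⬝ᵥ M *ᵥ x| ≤ specNorm M * (x ⬝ᵥ x) := by
  have h1 : x ⬝ᵥ M *ᵥ x = inner ℝ (WithLp.toLp 2 x)
      (Matrix.toEuclideanCLM (n := Fin m) (𝕜 := ℝ) M (WithLp.toLp 2 x)) := by
    rw [EuclideanSpace.inner_eq_star_dotProduct, dotProduct_comm]
    simp
  have h2 : x ⬝ᵥ x = ‖WithLp.toLp 2 x‖ ^ 2 := by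
    rw [← real_inner_self_eq_norm_sq, EuclideanSpace.inner_eq_star_dotProduct]
    simp
  rw [h1, h2]
  calc _ ≤ ‖WithLp.toLp 2 x‖ * ‖Matrix.toEuclideanCLM (n := Fin m) (𝕜 := ℝ) M (WithLp.toLp 2 x)‖ :=
        abs_real_inner_le_norm _ _
    _ ≤ ‖WithLp.toLp 2 x‖ * (specNorm M * ‖WithLp.toLp 2 x‖) := by
        gcongr
        exact ContinuousLinearMap.le_opNorm _ _
    _ = _ := by ring

theorem specNorm_pos {m : ℕ} {M : Matrix (Fin m) (Fin m) ℝ} (hM : M ≠ 0) : 0 < specNorm M := by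
  unfold specNorm
  rw [norm_pos_iff]
  exact fun h => hM (by simpa using h)

/-! ### The Laplacian of the rescaled weights -/

open Matrix in
theorem dotProduct_symPart {m : ℕ} (M : Matrix (Fin m) (Fin m) ℝ) (x : Fin m → ℝ) :
    x ⬝ᵥ symPart M *ᵥ x = x ⬝ᵥ M *ᵥ x := by
  unfold symPart
  have h : x ⬝ᵥ x ᵥ* M = x ⬝ᵥ M *ᵥ x := by rw [dotProduct_comm, dotProduct_mulVec]
  rw [smul_mulVec, add_mulVec, dotProduct_smul, dotProduct_add, mulVec_transpose, h, smul_eq_mul]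
  ring

theorem symPart_isSymm {m : ℕ} (M : Matrix (Fin m) (Fin m) ℝ) : (symPart M).IsSymm := by
  unfold symPart
  rw [Matrix.IsSymm, Matrix.transpose_smul, Matrix.transpose_add, Matrix.transpose_transpose,
    add_comm]

open Matrix in
theorem laplacian_mulVec (A : Matrix (Fin N) (Fin N) ℝ) (x : Fin N → ℝ) (i : Fin N) :
    (laplacian A *ᵥ x) i = ∑ j, A i j * (x i - x j) := by
  unfold laplacian
  rw [sub_mulVec, Pi.sub_apply, mulVec_diagonal, Finset.sum_mul, mulVec, dotProduct,
    ← Finset.sum_sub_distrib]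
  exact Finset.sum_congr rfl fun j _ => by ring

open Matrix in
-- Balance makes the sums of A_ij x_i² and A_ij x_j² equal, so the form is an edge energy even for
-- asymmetric weights.
theorem dotProduct_laplacian_mulVec (A : Matrix (Fin N) (Fin N) ℝ)
    (hA : ∀ j, ∑ i, A i j = ∑ i, A j i) (x : Fin N → ℝ) :
    x ⬝ᵥ laplacian A *ᵥ x = 1 / 2 * ∑ i, ∑ j, A i j * (x i - x j) ^ 2 := by
  have h1 : x ⬝ᵥ laplacian A *ᵥ x = ∑ i, ∑ j, A i j * (x i ^ 2 - x i * x j) := by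
    refine Finset.sum_congr rfl fun i _ => ?_
    rw [laplacian_mulVec, Finset.mul_sum]
    exact Finset.sum_congr rfl fun j _ => by ring
  have h2 : ∑ i, ∑ j, A i j * x j ^ 2 = ∑ i, ∑ j, A i j * x i ^ 2 := by
    rw [Finset.sum_comm]
    refine Finset.sum_congr rfl fun i _ => ?_
    rw [← Finset.sum_mul, ← Finset.sum_mul, hA]
  have h3 : ∑ i, ∑ j, A i j * (x i - x j) ^ 2 =
      (∑ i, ∑ j, A i j * (x i ^ 2 - x i * x j)) + ((∑ i, ∑ j, A i j * x j ^ 2) -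
        ∑ i, ∑ j, A i j * x i ^ 2) + ∑ i, ∑ j, A i j * (x i ^ 2 - x i * x j) := by
    simp only [← Finset.sum_add_distrib, ← Finset.sum_sub_distrib]
    exact Finset.sum_congr rfl fun i _ => Finset.sum_congr rfl fun j _ => by ring
  rw [h1, h3, h2]
  ring

/-- This is the purpose of the rescaling: a left null vector of the Laplacian is exactly what
balances in- and out-weights. -/
theorem sum_scaledWeights_comm {Abar : Matrix (Fin N) (Fin N) ℝ} {ω : Fin N → ℝ}
    (hωL : Matrix.vecMul ω (laplacian Abar) = 0) (j : Fin N) :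
    ∑ i, scaledWeights ω Abar i j = ∑ i, scaledWeights ω Abar j i := by
  have h := congrFun hωL j
  unfold laplacian at h
  rw [Matrix.vecMul_sub, Pi.sub_apply, Matrix.vecMul_diagonal, Pi.zero_apply, sub_eq_zero,
    Finset.mul_sum] at h
  simpa [scaledWeights, Matrix.vecMul, dotProduct] using h.symm

theorem scaledWeights_nonneg {G : Digraph (Fin N)} {Abar : Matrix (Fin N) (Fin N) ℝ}
    (hAbar : IsAdjacencyMatrix G Abar) {ω : Fin N → ℝ} (hω : ∀ i, 0 < ω i) (i j : Fin N) :
    0 ≤ scaledWeights ω Abar i j := by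
  refine mul_nonneg (hω i).le ?_
  by_cases h : G.Adj j i
  · exact ((hAbar i j).1 h).le
  · exact ((hAbar i j).2 h).ge

open Matrix in
theorem laplacian_quadratic_nonneg {G : Digraph (Fin N)} {Abar : Matrix (Fin N) (Fin N) ℝ}
    (hAbar : IsAdjacencyMatrix G Abar) {ω : Fin N → ℝ} (hω : ∀ i, 0 < ω i)
    (hωL : Matrix.vecMul ω (laplacian Abar) = 0) (x : Fin N → ℝ) :
    0 ≤ x ⬝ᵥ laplacian (scaledWeights ω Abar) *ᵥ x := by
  rw [dotProduct_laplacian_mulVec _ (sum_scaledWeights_comm hωL)]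
  have := fun i j => scaledWeights_nonneg hAbar hω i j
  have : 0 ≤ ∑ i, ∑ j, scaledWeights ω Abar i j * (x i - x j) ^ 2 :=
    Finset.sum_nonneg fun i _ => Finset.sum_nonneg fun j _ => mul_nonneg (this i j) (sq_nonneg _)
  linarith

open Matrix in
-- Zero energy forces equality across every edge, and directed paths propagate it.
theorem eq_of_laplacian_quadratic_eq_zero {G : Digraph (Fin N)} (hG : StronglyConnected G)
    {Abar : Matrix (Fin N) (Fin N) ℝ} (hAbar : IsAdjacencyMatrix G Abar) {ω : Fin N → ℝ}
    (hω : ∀ i, 0 < ω i) (hωL : Matrix.vecMul ω (laplacian Abar) = 0) {x : Fin N → ℝ}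
    (hx : x ⬝ᵥ laplacian (scaledWeights ω Abar) *ᵥ x = 0) (i j : Fin N) : x i = x j := by
  rw [dotProduct_laplacian_mulVec _ (sum_scaledWeights_comm hωL)] at hx
  have hnn : ∀ i j, 0 ≤ scaledWeights ω Abar i j * (x i - x j) ^ 2 := fun i j =>
    mul_nonneg (scaledWeights_nonneg hAbar hω i j) (sq_nonneg _)
  have h0 : ∑ i, ∑ j, scaledWeights ω Abar i j * (x i - x j) ^ 2 = 0 := by linarith
  have hstep : ∀ k l, G.Adj k l → x k = x l := by
    intro k l hkl
    have h1 := (Finset.sum_eq_zero_iff_of_nonneg fun i _ =>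
      Finset.sum_nonneg fun j _ => hnn i j).1 h0 l (Finset.mem_univ _)
    have h2 := (Finset.sum_eq_zero_iff_of_nonneg fun j _ => hnn l j).1 h1 k (Finset.mem_univ _)
    have h3 : 0 < scaledWeights ω Abar l k := mul_pos (hω l) ((hAbar l k).1 hkl)
    have h4 := (mul_eq_zero.1 h2).resolve_left h3.ne'
    exact (sub_eq_zero.1 (pow_eq_zero_iff two_ne_zero |>.1 h4)).symm
  induction hG i j with
  | refl => rfl
  | tail _ h ih => exact ih.trans (hstep _ _ h)

open Matrix in
-- Eigenvectors with nonpositive eigenvalue have zero energy, hence are constant and orthogonal to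
-- zero-sum vectors; the other eigenvalues are at least λ₂.
theorem minPosEigenvalue_laplacian (hN : 2 ≤ N) {G : Digraph (Fin N)} (hG : StronglyConnected G)
    {Abar : Matrix (Fin N) (Fin N) ℝ} (hAbar : IsAdjacencyMatrix G Abar) {ω : Fin N → ℝ}
    (hω : ∀ i, 0 < ω i) (hωL : Matrix.vecMul ω (laplacian Abar) = 0) :
    0 < minPosEigenvalue (symPart (laplacian (scaledWeights ω Abar))) ∧
    ∀ x : Fin N → ℝ, ∑ i, x i = 0 →
      minPosEigenvalue (symPart (laplacian (scaledWeights ω Abar))) * (x ⬝ᵥ x) ≤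
        x ⬝ᵥ laplacian (scaledWeights ω Abar) *ᵥ x := by
  obtain ⟨l, b, hb, hl, hx, hq⟩ := exists_spectral_decomposition
    (symPart_isSymm (laplacian (scaledWeights ω Abar)))
  simp only [dotProduct_symPart] at hq
  set l₂ := minPosEigenvalue (symPart (laplacian (scaledWeights ω Abar))) with hl₂
  have hset : {r : ℝ | 0 < r ∧ Module.End.HasEigenvalue
      (Matrix.toLin' (symPart (laplacian (scaledWeights ω Abar)))) r} = range l ∩ Ioi 0 := by
    rw [← hl]
    ext r
    simp [and_comm]
  have hfin : (range l ∩ Ioi 0).Finite := (finite_range l).inter_of_left _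
  unfold minPosEigenvalue at hl₂
  rw [hset] at hl₂
  have hconst : ∀ i, l i ≤ 0 → ∀ j k, b i j = b i k := fun i hi => by
    refine eq_of_laplacian_quadratic_eq_zero hG hAbar hω hωL
      (le_antisymm ?_ (laplacian_quadratic_nonneg hAbar hω hωL _))
    rw [← dotProduct_symPart, hb i, dotProduct_smul, smul_eq_mul]
    exact mul_nonpos_of_nonpos_of_nonneg hi (Finset.sum_nonneg fun j _ => mul_self_nonneg _)
  have hne : (range l ∩ Ioi 0).Nonempty := by
    by_contra hemp
    have hle : ∀ i, l i ≤ 0 := fun i => by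
      by_contra h
      exact hemp ⟨l i, mem_range_self i, not_le.1 h⟩
    -- Without positive eigenvalues this vector would have zero energy and be constant, which fails
    -- for two or more players.
    let e : Fin N → ℝ := Pi.single ⟨0, by omega⟩ 1
    have h0 : e ⬝ᵥ laplacian (scaledWeights ω Abar) *ᵥ e = 0 := by
      refine le_antisymm ?_ (laplacian_quadratic_nonneg hAbar hω hωL _)
      rw [hq]
      exact Finset.sum_nonpos fun i _ => mul_nonpos_of_nonpos_of_nonneg (hle i) (sq_nonneg _)
    have := eq_of_laplacian_quadratic_eq_zero hG hAbar hω hωL h0 ⟨0, by omega⟩ ⟨1, by omega⟩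
    simp [e] at this
  refine ⟨hl₂ ▸ (hne.csInf_mem hfin).2, fun x hx0 => ?_⟩
  rw [hx, hq, Finset.mul_sum]
  refine Finset.sum_le_sum fun i _ => ?_
  by_cases hi : 0 < l i
  · refine mul_le_mul_of_nonneg_right ?_ (sq_nonneg _)
    rw [hl₂]
    exact csInf_le hfin.bddBelow ⟨mem_range_self i, hi⟩
  · have : b i ⬝ᵥ x = 0 := by
      have h1 : b i = fun _ => b i ⟨0, by omega⟩ := funext fun j => hconst i (not_lt.1 hi) _ _
      rw [h1, dotProduct, ← Finset.mul_sum, hx0, mul_zero]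
    simp [this]

/-! ### Passing from scalars to stacked estimates -/

open Matrix in
/-- A lower bound for the quadratic form of a Laplacian carries over to its product with the
identity. -/
theorem mul_norm_sq_le_sum_inner {M : Matrix (Fin N) (Fin N) ℝ} {α : ℝ} {S : Set (Fin N → ℝ)}
    (h : ∀ v ∈ S, α * (v ⬝ᵥ v) ≤ v ⬝ᵥ laplacian M *ᵥ v) (x : Estimates d)
    (hx : ∀ k l, (fun i => x i k l) ∈ S) :
    α * ‖x‖ ^ 2 ≤ ∑ i, inner ℝ (x i) (∑ j, M i j • (x i - x j)) := by
  -- For fixed block `k` and coordinate `l` the estimates form a scalar vector indexed by players;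
  -- both sides are sums over `(k, l)`.
  have h1 : ‖x‖ ^ 2 = ∑ k, ∑ l, ((fun i => x i k l) ⬝ᵥ (fun i => x i k l)) := by
    rw [← real_inner_self_eq_norm_sq]
    simp only [PiLp.inner_apply, dotProduct]
    rw [Finset.sum_comm]
    refine Finset.sum_congr rfl fun k _ => ?_
    rw [Finset.sum_comm]
    simp [sq]
  have h2 : ∑ i, inner ℝ (x i) (∑ j, M i j • (x i - x j)) =
      ∑ k, ∑ l, ((fun i => x i k l) ⬝ᵥ laplacian M *ᵥ (fun i => x i k l)) := by
    simp only [PiLp.inner_apply, dotProduct, laplacian_mulVec]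
    rw [Finset.sum_comm]
    refine Finset.sum_congr rfl fun k _ => ?_
    rw [Finset.sum_comm]
    refine Finset.sum_congr rfl fun l _ => Finset.sum_congr rfl fun i _ => ?_
    simp [mul_comm]
  rw [h1, h2, Finset.mul_sum]
  refine Finset.sum_le_sum fun k _ => ?_
  rw [Finset.mul_sum]
  exact Finset.sum_le_sum fun l _ => h _ (hx k l)

/-! ### The Nash equilibrium -/

/-- On the line from `a` to `y`, the slope of a convex function over `[0, 1]` is at least its
derivative at 0, here zero. -/
theorem isMinOn_of_gradient_eq_zero {E : Type*} [NormedAddCommGroup E] [InnerProductSpace ℝ E]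
    [CompleteSpace E] {f : E → ℝ} (hf : ConvexOn ℝ univ f) {a : E} (hd : DifferentiableAt ℝ f a)
    (h0 : gradient f a = 0) (y : E) : f a ≤ f y := by
  let φ : ℝ → ℝ := fun s => f (a + s • (y - a))
  have hφ : ConvexOn ℝ univ φ := by
    have := hf.comp_affineMap (AffineMap.lineMap a y)
    refine ⟨convex_univ, fun s _ t _ p q hp hq hpq => ?_⟩
    have h1 := this.2 (x := s) (mem_univ _) (y := t) (mem_univ _) hp hq hpq
    simpa only [φ, Function.comp_apply, AffineMap.lineMap_apply_module', add_comm] using h1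
  have hd0 : HasDerivAt φ 0 0 := by
    have h1 : HasFDerivAt f (0 : E →L[ℝ] ℝ) (a + (0 : ℝ) • (y - a)) := by
      have := hd.hasGradientAt.hasFDerivAt
      rw [h0, map_zero] at this
      simpa using this
    have h2 : HasDerivAt (fun s : ℝ => a + s • (y - a)) ((1 : ℝ) • (y - a)) 0 :=
      ((hasDerivAt_id (0 : ℝ)).smul_const (y - a)).const_add a
    exact (h1.comp_hasDerivAt (0 : ℝ) h2).congr_deriv (by simp)
  have h := hφ.le_slope_of_hasDerivAt (mem_univ 0) (mem_univ 1) one_pos hd0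
  simpa [slope, φ] using h

@[simp]
theorem replace_self (x : Profile d) (i : Fin N) : replace x i (x i) = x := by
  unfold replace
  rw [Function.update_eq_self]

theorem isNash_iff_pseudoGrad_eq_zero {J : Fin N → Profile d → ℝ} (hJ : CostAssumption J)
    (x : Profile d) : IsNash J x ↔ pseudoGrad J x = 0 := by
  have hd : ∀ i, DifferentiableAt ℝ (fun y => J i (replace x i y)) (x i) := fun i =>
    ((hJ i x).1.differentiable (by norm_num)) _
  constructor
  · intro h
    ext1 i
    have hmin : IsLocalMin (fun y => J i (replace x i y)) (x i) :=
      Filter.Eventually.of_forall fun y => by simpa using h i y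
    change gradient _ _ = 0
    rw [gradient, hmin.fderiv_eq_zero, map_zero]
  · intro h i y
    have h0 : gradient (fun y => J i (replace x i y)) (x i) = 0 :=
      congrArg (fun z : Profile d => z i) h
    simpa using isMinOn_of_gradient_eq_zero (hJ i x).2.1.convexOn (hd i) h0 y

theorem exists_zero_of_stronglyMonotone {F : Profile d → Profile d} {ε ι : ℝ} (hε : 0 < ε)
    (hι : 0 < ι) (hmono : StronglyMonotone ε F) (hlip : IsLipschitz ι F) :
    ∃ x, F x = 0 ∧ ∀ y, F y = 0 → y = x := by
  obtain ⟨x, hx⟩ : ∃ x, F x = 0 := by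
    -- The step that minimises 1 - 2γε + γ²ι², the squared Lipschitz bound of `x - γ • F x`.
    set γ := ε / ι ^ 2 with hγ
    have hγ0 : 0 < γ := by positivity
    -- If all action spaces are trivial, `ε` may exceed `ι`; `max 0` keeps the radicand nonnegative.
    set q := Real.sqrt (max 0 (1 - ε ^ 2 / ι ^ 2)) with hq
    have hq1 : q < 1 := by
      rw [hq, Real.sqrt_lt' one_pos]
      have : 0 < ε ^ 2 / ι ^ 2 := by positivity
      exact max_lt (by norm_num) (by linarith)
    have hq0 : 0 ≤ q := Real.sqrt_nonneg _
    have hT : ContractingWith q.toNNReal (fun x => x - γ • F x) := by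
      refine ⟨by rwa [Real.toNNReal_lt_one], LipschitzWith.of_dist_le_mul fun x y => ?_⟩
      rw [Real.coe_toNNReal _ hq0, dist_eq_norm, dist_eq_norm]
      refine abs_le_of_sq_le_sq' ?_ (by positivity) |>.2
      have h1 : x - γ • F x - (y - γ • F y) = (x - y) - γ • (F x - F y) := by
        rw [smul_sub]; abel
      have h2 := hmono x y
      have h3 : ‖F x - F y‖ ^ 2 ≤ (ι * ‖x - y‖) ^ 2 := by
        gcongr
        exact hlip x y
      rw [h1, norm_sub_sq_real, inner_smul_right, norm_smul, Real.norm_of_nonneg hγ0.le, mul_pow,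
        mul_pow]
      have h4 : q ^ 2 = max 0 (1 - ε ^ 2 / ι ^ 2) := Real.sq_sqrt (le_max_left _ _)
      have h5 : (1 - ε ^ 2 / ι ^ 2) * ‖x - y‖ ^ 2 ≤ q ^ 2 * ‖x - y‖ ^ 2 := by
        rw [h4]
        gcongr
        exact le_max_right _ _
      have h6 : γ ^ 2 * ‖F x - F y‖ ^ 2 ≤ γ ^ 2 * (ι * ‖x - y‖) ^ 2 := by gcongr
      have h7 : γ * (ε * ‖x - y‖ ^ 2) ≤ γ * inner ℝ (x - y) (F x - F y) := by gcongr
      have h8 : γ ^ 2 * (ι * ‖x - y‖) ^ 2 = ε ^ 2 / ι ^ 2 * ‖x - y‖ ^ 2 := by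
        rw [hγ]; field_simp
      have h9 : γ * (ε * ‖x - y‖ ^ 2) = ε ^ 2 / ι ^ 2 * ‖x - y‖ ^ 2 := by
        rw [hγ]; field_simp
      nlinarith
    have hfix : hT.fixedPoint - γ • F hT.fixedPoint = hT.fixedPoint := hT.fixedPoint_isFixedPt
    refine ⟨hT.fixedPoint, ?_⟩
    have := sub_eq_self.1 hfix
    exact (smul_eq_zero.1 this).resolve_left hγ0.ne'
  refine ⟨x, hx, fun y hy => ?_⟩
  have h := hmono y x
  rw [hx, hy, sub_zero, inner_zero_right] at h
  have h1 : ‖y - x‖ ^ 2 ≤ 0 := by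
    by_contra hc
    have := mul_pos hε (not_le.1 hc)
    linarith
  have h2 : ‖y - x‖ = 0 := by
    have := sq_nonneg ‖y - x‖
    exact pow_eq_zero_iff two_ne_zero |>.1 (le_antisymm h1 this)
  exact sub_eq_zero.1 (norm_eq_zero.1 h2)

/-! ### Splitting the error into its average and the disagreement -/

/-- The average over the players. -/
noncomputable def average (e : Estimates d) : Profile d := (N : ℝ)⁻¹ • ∑ i, e i

/-- The deviation of the estimates from their average. -/
noncomputable def disagreement (e : Estimates d) : Estimates d := e - stackedCopy (average e)

theorem disagreement_apply (e : Estimates d) (i : Fin N) :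
    disagreement e i = e i - average e := rfl

theorem sum_disagreement (hN : 0 < N) (e : Estimates d) : ∑ i, disagreement e i = 0 := by
  have hN' : (N : ℝ) ≠ 0 := by positivity
  simp only [disagreement_apply, Finset.sum_sub_distrib, Finset.sum_const, Finset.card_univ,
    Fintype.card_fin, average]
  rw [← Nat.cast_smul_eq_nsmul ℝ, smul_smul, mul_inv_cancel₀ hN', one_smul, sub_self]

theorem norm_sq_eq_average_add_disagreement (hN : 0 < N) (e : Estimates d) :
    ‖e‖ ^ 2 = N * ‖average e‖ ^ 2 + ‖disagreement e‖ ^ 2 := by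
  have h1 : ∀ i, ‖e i‖ ^ 2 =
      ‖average e‖ ^ 2 + 2 * inner ℝ (average e) (disagreement e i) + ‖disagreement e i‖ ^ 2 := by
    intro i
    rw [← norm_add_sq_real, disagreement_apply, add_sub_cancel]
  rw [PiLp.norm_sq_eq_of_L2, PiLp.norm_sq_eq_of_L2 _ (disagreement e),
    Finset.sum_congr rfl fun i _ => h1 i, Finset.sum_add_distrib, Finset.sum_add_distrib,
    ← Finset.mul_sum, ← inner_sum, sum_disagreement hN]
  simp

/-- The stacked partial gradients `col(∇₁J₁(x¹), …, ∇_N J_N(x^N))` at the estimates. -/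
noncomputable def extendedGrad (J : Fin N → Profile d → ℝ) (x : Estimates d) : Profile d :=
  WithLp.toLp 2 (fun i => partialGrad J i (x i))

/-- The actual actions `col(x¹₁, …, x^N_N)`. -/
def ownBlocks (x : Estimates d) : Profile d := WithLp.toLp 2 (fun i => x i i)

theorem norm_ownBlocks_le (x : Estimates d) : ‖ownBlocks x‖ ≤ ‖x‖ := by
  refine abs_le_of_sq_le_sq' ?_ (norm_nonneg _) |>.2
  rw [PiLp.norm_sq_eq_of_L2, PiLp.norm_sq_eq_of_L2]
  refine Finset.sum_le_sum fun i _ => ?_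
  have := PiLp.norm_apply_le (x i) i
  change ‖x i i‖ ^ 2 ≤ _
  gcongr

/-- Player `i` contributes only block `i` of F at its own estimate, so the squared Lipschitz bounds
add up with no loss in the constant. -/
theorem norm_extendedGrad_sub_le {J : Fin N → Profile d → ℝ} {ι : ℝ} (hι : 0 ≤ ι)
    (hlip : IsLipschitz ι (pseudoGrad J)) (x : Estimates d) (y : Profile d) :
    ‖extendedGrad J x - pseudoGrad J y‖ ≤ ι * ‖x - stackedCopy y‖ := by
  refine abs_le_of_sq_le_sq' ?_ (by positivity) |>.2
  rw [mul_pow, PiLp.norm_sq_eq_of_L2, PiLp.norm_sq_eq_of_L2, Finset.mul_sum]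
  refine Finset.sum_le_sum fun i _ => ?_
  rw [← mul_pow]
  have h1 := PiLp.norm_apply_le (pseudoGrad J (x i) - pseudoGrad J y) i
  have h2 := hlip (x i) y
  change ‖(pseudoGrad J (x i) - pseudoGrad J y) i‖ ^ 2 ≤ (ι * ‖x i - y‖) ^ 2
  gcongr
  exact h1.trans h2

theorem sum_inner_single (e : Estimates d) (g : Profile d) :
    ∑ i, inner ℝ (e i) (PiLp.single 2 i (g i) : Profile d) = inner ℝ (ownBlocks e) g := by
  rw [PiLp.inner_apply]
  refine Finset.sum_congr rfl fun i _ => ?_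
  rw [PiLp.inner_apply, Finset.sum_eq_single i]
  · simp [ownBlocks]
  · intro j _ hj
    simp [hj]
  · simp

/-- The reference point is `xs + m`: the estimates differ from its stacked copy by exactly `w`.
Strong monotonicity handles the pairing of `m` with F there; the Lipschitz bound handles the three
other terms, of sizes ι‖m‖‖w‖ (twice) and ι‖w‖². -/
theorem le_inner_ownBlocks_extendedGrad {J : Fin N → Profile d → ℝ} {ε ι : ℝ}
    (hι : 0 ≤ ι) (hmono : StronglyMonotone ε (pseudoGrad J))
    (hlip : IsLipschitz ι (pseudoGrad J)) {xs : Profile d} (hxs : pseudoGrad J xs = 0)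
    (x : Estimates d) :
    ε * ‖average (x - stackedCopy xs)‖ ^ 2 -
        2 * ι * ‖average (x - stackedCopy xs)‖ * ‖disagreement (x - stackedCopy xs)‖ -
        ι * ‖disagreement (x - stackedCopy xs)‖ ^ 2 ≤
      inner ℝ (ownBlocks (x - stackedCopy xs)) (extendedGrad J x) := by
  set e := x - stackedCopy xs with he
  set m := average e
  set w := disagreement e with hw
  have hdec : ownBlocks e = m + ownBlocks w := by
    ext1 i
    change e i i = m i + (e i - m) i
    simp
  have hx : x - stackedCopy (xs + m) = w := by
    ext1 i
    change x i - (xs + m) = (x i - xs) - m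
    abel
  have h1 := norm_extendedGrad_sub_le hι hlip x (xs + m)
  rw [hx] at h1
  have h2 := hlip (xs + m) xs
  have h3 := hmono (xs + m) xs
  rw [hxs, sub_zero, add_sub_cancel_left] at h2 h3
  have h4 := norm_ownBlocks_le w
  have hsplit : inner ℝ (ownBlocks e) (extendedGrad J x) =
      inner ℝ m (pseudoGrad J (xs + m)) + inner ℝ m (extendedGrad J x - pseudoGrad J (xs + m)) +
      inner ℝ (ownBlocks w) (pseudoGrad J (xs + m)) +
      inner ℝ (ownBlocks w) (extendedGrad J x - pseudoGrad J (xs + m)) := by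
    rw [hdec, inner_add_left, inner_sub_right, inner_sub_right]
    ring
  have hb : ∀ (u v : Profile d) (p q : ℝ), ‖u‖ ≤ p → ‖v‖ ≤ q → 0 ≤ p → -(p * q) ≤ inner ℝ u v :=
    fun u v p q hp hq hp0 => (neg_le_neg (mul_le_mul hp hq (norm_nonneg _) hp0)).trans
      (abs_le.1 (abs_real_inner_le_norm u v)).1
  have i1 := hb m _ _ _ le_rfl h1 (norm_nonneg _)
  have i2 := hb (ownBlocks w) _ _ _ h4 h2 (norm_nonneg _)
  have i3 := hb (ownBlocks w) _ _ _ h4 h1 (norm_nonneg _)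
  rw [hsplit]
  nlinarith

/-! ### The consensus terms -/

/-- The average cancels in the differences, and by balance it also drops out of the left factor. -/
theorem sum_inner_laplacian_eq_disagreement {a : Matrix (Fin N) (Fin N) ℝ}
    (ha : ∀ j, ∑ i, a i j = ∑ i, a j i) (e : Estimates d) :
    ∑ i, inner ℝ (e i) (∑ j, a i j • (e i - e j)) =
      ∑ i, inner ℝ (disagreement e i)
        (∑ j, a i j • (disagreement e i - disagreement e j)) := by
  have h0 : ∑ i, ∑ j, a i j • (e i - e j) = 0 := by
    simp only [smul_sub, Finset.sum_sub_distrib]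
    rw [sub_eq_zero, Finset.sum_comm (f := fun i j => a i j • e j)]
    refine Finset.sum_congr rfl fun i _ => ?_
    rw [← Finset.sum_smul, ← Finset.sum_smul, ha]
  simp only [disagreement_apply, sub_sub_sub_cancel_right, inner_sub_left, Finset.sum_sub_distrib]
  rw [← inner_sum, h0, inner_zero_right, sub_zero]

/-! ### The rates as bounds of quadratic forms -/

theorem dotProduct_two_smul_mulVec (p q r : ℝ) (x : Fin 2 → ℝ) :
    x ⬝ᵥ Matrix.mulVec ((2 : ℝ) • !![p, q; q, r]) x =
      2 * (p * x 0 ^ 2 + 2 * q * x 0 * x 1 + r * x 1 ^ 2) := by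
  simp [Matrix.mulVec, dotProduct, Fin.sum_univ_two]
  ring

theorem two_smul_isSymm (p q r : ℝ) : ((2 : ℝ) • !![p, q; q, r]).IsSymm := by
  ext i j
  fin_cases i <;> fin_cases j <;> simp

/-- Completing the square leaves κλ₂ - ι - ι²/ε as the coefficient of the second square; the bound
on κ says that it is positive. -/
theorem decayRate_pos {ε ι κ l₂ : ℝ} (hN : 0 < N) (hε : 0 < ε) (hl : 0 < l₂)
    (hκ : 1 / l₂ * (ι ^ 2 / ε + ι) < κ) : 0 < decayRate N ε ι κ l₂ := by
  have hN' : (0 : ℝ) < N := by exact_mod_cast hN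
  have hκ' : ι ^ 2 / ε + ι < κ * l₂ := by
    rw [one_div, inv_mul_lt_iff₀ hl] at hκ
    linarith
  refine minEigenvalue_pos (two_smul_isSymm _ _ _) fun x hx => ?_
  have hs : (√N) ^ 2 = (N : ℝ) := Real.sq_sqrt hN'.le
  have hs0 : 0 < √(N : ℝ) := Real.sqrt_pos.2 hN'
  rw [dotProduct_two_smul_mulVec]
  generalize √(N : ℝ) = s at hs hs0
  rw [← hs, show 2 * (ε / s ^ 2 * x 0 ^ 2 + 2 * -(ι / s) * x 0 * x 1 + (κ * l₂ - ι) * x 1 ^ 2) =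
    2 * (ε * (x 0 / s - ι / ε * x 1) ^ 2 + (κ * l₂ - ι - ι ^ 2 / ε) * x 1 ^ 2) by field_simp; ring]
  have hpos : 0 < κ * l₂ - ι - ι ^ 2 / ε := by linarith
  by_cases h1 : x 1 = 0
  · have h0 : x 0 ≠ 0 := fun h0 => hx (by ext i; fin_cases i <;> simp [h0, h1])
    rw [h1]
    have : 0 < (x 0 / s - ι / ε * 0) ^ 2 := by
      have : x 0 / s ≠ 0 := div_ne_zero h0 hs0.ne'
      rw [mul_zero, sub_zero]
      positivity
    positivity
  · positivity

theorem decayRate_mul_le {ε ι κ l₂ : ℝ} (hN : 0 < N) (m w : ℝ) :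
    decayRate N ε ι κ l₂ * (N * m ^ 2 + w ^ 2) ≤
      2 * (ε * m ^ 2 - 2 * ι * m * w + (κ * l₂ - ι) * w ^ 2) := by
  have hN' : (0 : ℝ) < N := by exact_mod_cast hN
  have hs : (√N) ^ 2 = (N : ℝ) := Real.sq_sqrt hN'.le
  have hs0 : 0 < √(N : ℝ) := Real.sqrt_pos.2 hN'
  -- With this test vector, the squared length is that of the whole error, N‖m‖² + ‖w‖².
  have h := minEigenvalue_mul_le (two_smul_isSymm (ε / N) (-(ι / √N)) (κ * l₂ - ι)) ![√N * m, w]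
  rw [dotProduct_two_smul_mulVec, ← decayRate] at h
  simp only [dotProduct, Fin.sum_univ_two, Matrix.cons_val_zero, Matrix.cons_val_one,
    Matrix.cons_val_fin_one] at h
  generalize √(N : ℝ) = s at hs hs0 h
  have e1 : s * m * (s * m) + w * w = N * m ^ 2 + w ^ 2 := by rw [← hs]; ring
  have e2 : 2 * (ε / N * (s * m) ^ 2 + 2 * -(ι / s) * (s * m) * w + (κ * l₂ - ι) * w ^ 2) =
      2 * (ε * m ^ 2 - 2 * ι * m * w + (κ * l₂ - ι) * w ^ 2) := by
    rw [← hs]; field_simp; ring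
  rwa [e1, e2] at h

theorem growthRate_pos {ε ι c : ℝ} (hι : 0 < ι) (hc : 0 ≤ c) : 0 < growthRate N ε ι c := by
  refine specNorm_pos fun h => ?_
  have := congrFun (congrFun h 1) 1
  simp at this
  linarith

/-- The off-diagonal `c` in the matrix only adds 4c√N·m·w, which is nonnegative and can be dropped.
-/
theorem le_growthRate_mul {ε ι c : ℝ} (hN : 0 < N) (hc : 0 ≤ c) {m w : ℝ} (hm : 0 ≤ m)
    (hw : 0 ≤ w) :
    2 * (-(ε * m ^ 2) + 2 * ι * m * w + ι * w ^ 2 + c * (N * m ^ 2 + w ^ 2)) ≤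
      growthRate N ε ι c * (N * m ^ 2 + w ^ 2) := by
  have hN' : (0 : ℝ) < N := by exact_mod_cast hN
  have hs : (√N) ^ 2 = (N : ℝ) := Real.sq_sqrt hN'.le
  have hs0 : 0 < √(N : ℝ) := Real.sqrt_pos.2 hN'
  have h := (le_abs_self _).trans (abs_dotProduct_mulVec_le
    ((2 : ℝ) • !![c - ε / N, c + ι / √N; c + ι / √N, c + ι]) ![√N * m, w])
  rw [dotProduct_two_smul_mulVec, ← growthRate] at h
  simp only [dotProduct, Fin.sum_univ_two, Matrix.cons_val_zero, Matrix.cons_val_one,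
    Matrix.cons_val_fin_one] at h
  generalize √(N : ℝ) = s at hs hs0 h
  have e1 : s * m * (s * m) + w * w = N * m ^ 2 + w ^ 2 := by rw [← hs]; ring
  have e2 : 2 * ((c - ε / N) * (s * m) ^ 2 + 2 * (c + ι / s) * (s * m) * w + (c + ι) * w ^ 2) =
      2 * (-(ε * m ^ 2) + 2 * ι * m * w + ι * w ^ 2 + c * (N * m ^ 2 + w ^ 2)) +
        4 * (c * s * m * w) := by
    rw [← hs]; field_simp; ring
  rw [e1, e2] at h
  have : 0 ≤ c * s * m * w := by positivity
  linarith

/-! ### The right-hand side of the algorithm -/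

open Classical in
/-- The consensus weights that are in force at time `t`. -/
noncomputable def effectiveWeights (κ : ℝ) (a : Matrix (Fin N) (Fin N) ℝ) (G : Digraph (Fin N))
    (A : DoSAttack N) (ψ : Fin N → Fin N → ℝ → ℤ) (t : ℝ) : Matrix (Fin N) (Fin N) ℝ :=
  if t ∈ A.active G then attackedWeights G ψ t else κ • a

theorem algorithmField_apply (J : Fin N → Profile d → ℝ) (κ : ℝ)
    (a : Matrix (Fin N) (Fin N) ℝ) (G : Digraph (Fin N)) (A : DoSAttack N)
    (ψ : Fin N → Fin N → ℝ → ℤ) (t : ℝ) (x : Estimates d) (i : Fin N) :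
    algorithmField J κ a G A ψ t x i =
      -(PiLp.single 2 i (partialGrad J i (x i)) : Profile d) -
        ∑ j, effectiveWeights κ a G A ψ t i j • (x i - x j) := by
  rw [sub_eq_add_neg]
  change _ + consensusTerm κ a G A ψ t x i = _
  congr 1
  unfold consensusTerm effectiveWeights
  split_ifs
  · rw [← Finset.sum_neg_distrib]
    exact Finset.sum_congr rfl fun j _ => by rw [← smul_neg, neg_sub]
  · rw [neg_smul, Finset.smul_sum]
    congr 1
    exact Finset.sum_congr rfl fun j _ => by rw [smul_smul]; rfl

theorem inner_algorithmField (J : Fin N → Profile d → ℝ) (κ : ℝ)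
    (a : Matrix (Fin N) (Fin N) ℝ) (G : Digraph (Fin N)) (A : DoSAttack N)
    (ψ : Fin N → Fin N → ℝ → ℤ) (t : ℝ) (x : Estimates d) (xs : Profile d) :
    inner ℝ (x - stackedCopy xs) (algorithmField J κ a G A ψ t x) =
      -inner ℝ (ownBlocks (x - stackedCopy xs)) (extendedGrad J x) -
        ∑ i, inner ℝ ((x - stackedCopy xs) i) (∑ j, effectiveWeights κ a G A ψ t i j •
          ((x - stackedCopy xs) i - (x - stackedCopy xs) j)) := by
  rw [PiLp.inner_apply, ← sum_inner_single, ← Finset.sum_neg_distrib, ← Finset.sum_sub_distrib]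
  refine Finset.sum_congr rfl fun i _ => ?_
  rw [algorithmField_apply, inner_sub_right, inner_neg_right]
  have : ∀ j, (x - stackedCopy xs) i - (x - stackedCopy xs) j = x i - x j := fun j =>
    sub_sub_sub_cancel_right _ _ xs
  simp only [this]
  rfl

theorem measurableSet_active (A : DoSAttack N) (G : Digraph (Fin N)) :
    MeasurableSet (A.active G) := by
  refine MeasurableSet.iUnion fun i => MeasurableSet.iUnion fun j => ?_
  have h : A.channel G i j = {_t : ℝ | G.Adj j i} ∩ ⋃ m : ℕ, {_t : ℝ | (m : ℕ∞) < A.count i j} ∩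
      ({A.onset i j m} ∪ Ico (A.onset i j m) (A.onset i j m + A.duration i j m)) := by
    ext t
    simp [DoSAttack.channel]
  rw [h]
  exact (MeasurableSet.const _).inter (MeasurableSet.iUnion fun m => (MeasurableSet.const _).inter
    ((measurableSet_singleton _).union measurableSet_Ico))

theorem measurable_effectiveWeights (κ : ℝ) (a : Matrix (Fin N) (Fin N) ℝ) (G : Digraph (Fin N))
    (A : DoSAttack N) {ψ : Fin N → Fin N → ℝ → ℤ} (hψ : ∀ i j, Measurable (ψ i j))
    (i j : Fin N) : Measurable fun t => effectiveWeights κ a G A ψ t i j := by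
  classical
  have h : (fun t => effectiveWeights κ a G A ψ t i j) = fun t =>
      if t ∈ A.active G then (if G.Adj j i ∧ ψ i j t = 0 then 1 else 0) else κ * a i j := by
    ext t
    unfold effectiveWeights
    split_ifs with h1 h2 <;> simp_all [attackedWeights]
  rw [h]
  refine Measurable.ite (measurableSet_active A G) (Measurable.ite ?_ measurable_const
    measurable_const) measurable_const
  exact MeasurableSet.inter (s₁ := {_t : ℝ | G.Adj j i}) (MeasurableSet.const _)
    (hψ i j (measurableSet_singleton 0))

theorem abs_effectiveWeights_le (κ : ℝ) (a : Matrix (Fin N) (Fin N) ℝ) (G : Digraph (Fin N))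
    (A : DoSAttack N) (ψ : Fin N → Fin N → ℝ → ℤ) (t : ℝ) (i j : Fin N) :
    |effectiveWeights κ a G A ψ t i j| ≤ 1 + |κ * a i j| := by
  classical
  unfold effectiveWeights
  split_ifs
  · have h1 := abs_nonneg (κ * a i j)
    simp only [attackedWeights, Matrix.of_apply]
    split_ifs
    · rw [abs_one]; linarith
    · rw [abs_zero]; linarith
  · simp

theorem norm_le_sum_norm_apply (x : Estimates d) : ‖x‖ ≤ ∑ i, ‖x i‖ := by
  refine abs_le_of_sq_le_sq' ?_ (Finset.sum_nonneg fun i _ => norm_nonneg _) |>.2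
  rw [PiLp.norm_sq_eq_of_L2]
  exact Finset.sum_sq_le_sq_sum_of_nonneg fun i _ => norm_nonneg _

theorem exists_lipschitz_algorithmField {J : Fin N → Profile d → ℝ} {ι : ℝ} (hι : 0 ≤ ι)
    (hlip : IsLipschitz ι (pseudoGrad J)) (κ : ℝ) (a : Matrix (Fin N) (Fin N) ℝ)
    (G : Digraph (Fin N)) (A : DoSAttack N) (ψ : Fin N → Fin N → ℝ → ℤ) :
    ∃ K, 0 ≤ K ∧ ∀ t x y,
      ‖algorithmField J κ a G A ψ t x - algorithmField J κ a G A ψ t y‖ ≤ K * ‖x - y‖ := by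
  -- Per block: `ι` from the gradient, and a factor 2 from the difference of two errors. The weight
  -- bound covers both modes, so the constant does not depend on time.
  refine ⟨∑ i, (ι + ∑ j, (1 + |κ * a i j|) * 2), by positivity, fun t x y => ?_⟩
  refine (norm_le_sum_norm_apply _).trans ?_
  rw [Finset.sum_mul]
  refine Finset.sum_le_sum fun i _ => ?_
  have hi : ∀ j, ‖x j - y j‖ ≤ ‖x - y‖ := fun j => PiLp.norm_apply_le (x - y) j
  have h1 : ‖partialGrad J i (x i) - partialGrad J i (y i)‖ ≤ ι * ‖x - y‖ :=
    calc _ ≤ ‖pseudoGrad J (x i) - pseudoGrad J (y i)‖ :=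
          PiLp.norm_apply_le (pseudoGrad J (x i) - pseudoGrad J (y i)) i
      _ ≤ ι * ‖x i - y i‖ := hlip _ _
      _ ≤ _ := by gcongr; exact hi i
  have h2 : (algorithmField J κ a G A ψ t x - algorithmField J κ a G A ψ t y) i =
      -(PiLp.single 2 i (partialGrad J i (x i) - partialGrad J i (y i)) : Profile d) -
        ∑ j, effectiveWeights κ a G A ψ t i j • ((x i - y i) - (x j - y j)) := by
    have h3 : ∀ j, (x i - y i) - (x j - y j) = (x i - x j) - (y i - y j) := fun j => by abel
    simp only [h3, smul_sub _ (x i - x _), Finset.sum_sub_distrib]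
    rw [PiLp.sub_apply, algorithmField_apply, algorithmField_apply, PiLp.single_sub]
    abel
  rw [h2, add_mul, Finset.sum_mul]
  refine (norm_sub_le _ _).trans (add_le_add ?_ ((norm_sum_le _ _).trans
    (Finset.sum_le_sum fun j _ => ?_)))
  · rw [norm_neg, PiLp.norm_single]
    exact h1
  · rw [norm_smul, mul_assoc]
    refine mul_le_mul (abs_effectiveWeights_le _ _ _ _ _ _ _ _) ?_ (norm_nonneg _) (by positivity)
    linarith [norm_sub_le (x i - y i) (x j - y j), hi i, hi j]

theorem measurable_algorithmField (J : Fin N → Profile d → ℝ) (κ : ℝ)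
    (a : Matrix (Fin N) (Fin N) ℝ) (G : Digraph (Fin N)) (A : DoSAttack N)
    {ψ : Fin N → Fin N → ℝ → ℤ} (hψ : ∀ i j, Measurable (ψ i j)) (x : Estimates d) :
    Measurable fun t => algorithmField J κ a G A ψ t x := by
  have h : (fun t => algorithmField J κ a G A ψ t x) = fun t => WithLp.toLp 2 (fun i =>
      -(PiLp.single 2 i (partialGrad J i (x i)) : Profile d) -
        ∑ j, effectiveWeights κ a G A ψ t i j • (x i - x j)) := by
    ext1 t
    ext1 i
    exact algorithmField_apply J κ a G A ψ t x i
  rw [h]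
  refine (WithLp.measurable_toLp 2 _).comp (measurable_pi_iff.2 fun i => ?_)
  refine measurable_const.sub (Finset.measurable_sum _ fun j _ => ?_)
  exact (measurable_effectiveWeights κ a G A hψ i j).smul_const _

theorem norm_algorithmField_zero_le (J : Fin N → Profile d → ℝ) (κ : ℝ)
    (a : Matrix (Fin N) (Fin N) ℝ) (G : Digraph (Fin N)) (A : DoSAttack N)
    (ψ : Fin N → Fin N → ℝ → ℤ) (t : ℝ) :
    ‖algorithmField J κ a G A ψ t 0‖ ≤ ∑ i, ‖partialGrad J i 0‖ := by
  refine (norm_le_sum_norm_apply _).trans (Finset.sum_le_sum fun i _ => ?_)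
  rw [algorithmField_apply]
  simp

theorem exists_isSolution {J : Fin N → Profile d → ℝ} {ι : ℝ} (hι : 0 ≤ ι)
    (hlip : IsLipschitz ι (pseudoGrad J)) (κ : ℝ) (a : Matrix (Fin N) (Fin N) ℝ)
    (G : Digraph (Fin N)) (A : DoSAttack N) {ψ : Fin N → Fin N → ℝ → ℤ}
    (hψ : ∀ i j, Measurable (ψ i j)) (t₀ : ℝ) (x₀ : Estimates d) :
    ∃ x : ℝ → Estimates d, IsSolution (algorithmField J κ a G A ψ) t₀ x ∧ x t₀ = x₀ := by
  obtain ⟨K, hK, hl⟩ := exists_lipschitz_algorithmField hι hlip κ a G A ψ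
  obtain ⟨x, hc, h0, h⟩ := exists_caratheodory_solution (algorithmField J κ a G A ψ)
    (measurable_algorithmField J κ a G A hψ) hK hl (norm_algorithmField_zero_le J κ a G A ψ) t₀ x₀
  exact ⟨x, ⟨hc.continuousOn, fun t ht => ⟨(h t ht).1, h0.symm ▸ (h t ht).2⟩⟩, h0⟩

/-! ### Decay and growth of the squared error -/

/-- The disagreement sums to zero in every coordinate, so the spectral gap applies to it and
completes the form behind `decayRate`. -/
theorem two_mul_inner_algorithmField_le_of_free (hN : 2 ≤ N) {J : Fin N → Profile d → ℝ}
    {ε ι κ : ℝ} (hι : 0 ≤ ι) (hκ : 0 ≤ κ) (hmono : StronglyMonotone ε (pseudoGrad J))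
    (hlip : IsLipschitz ι (pseudoGrad J)) {G : Digraph (Fin N)} (hG : StronglyConnected G)
    {Abar : Matrix (Fin N) (Fin N) ℝ} (hAbar : IsAdjacencyMatrix G Abar) {ω : Fin N → ℝ}
    (hω : ∀ i, 0 < ω i) (hωL : Matrix.vecMul ω (laplacian Abar) = 0) {xs : Profile d}
    (hxs : pseudoGrad J xs = 0) (A : DoSAttack N) (ψ : Fin N → Fin N → ℝ → ℤ) {t : ℝ}
    (ht : t ∉ A.active G) (x : Estimates d) :
    2 * inner ℝ (x - stackedCopy xs) (algorithmField J κ (scaledWeights ω Abar) G A ψ t x) ≤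
      -decayRate N ε ι κ (minPosEigenvalue (symPart (laplacian (scaledWeights ω Abar)))) *
        ‖x - stackedCopy xs‖ ^ 2 := by
  have hN0 : 0 < N := by omega
  set l₂ := minPosEigenvalue (symPart (laplacian (scaledWeights ω Abar)))
  have h1 := le_inner_ownBlocks_extendedGrad hι hmono hlip hxs x
  set e := x - stackedCopy xs with he
  have h2 := mul_norm_sq_le_sum_inner (S := {v | ∑ i, v i = 0})
    (minPosEigenvalue_laplacian hN hG hAbar hω hωL).2 (disagreement e) (fun k l => by
      have := congrArg (fun z : Profile d => z k l) (sum_disagreement hN0 e)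
      simpa using this)
  rw [← sum_inner_laplacian_eq_disagreement (sum_scaledWeights_comm hωL)] at h2
  have h3 : ∑ i, inner ℝ (e i) (∑ j,
      effectiveWeights κ (scaledWeights ω Abar) G A ψ t i j • (e i - e j)) =
      κ * ∑ i, inner ℝ (e i) (∑ j, scaledWeights ω Abar i j • (e i - e j)) := by
    unfold effectiveWeights
    rw [if_neg ht, Finset.mul_sum]
    refine Finset.sum_congr rfl fun i _ => ?_
    rw [← inner_smul_right, Finset.smul_sum]
    simp only [smul_smul]
    rfl
  have h4 := mul_le_mul_of_nonneg_left h2 hκ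
  have h5 := decayRate_mul_le (ε := ε) (ι := ι) (κ := κ) (l₂ := l₂) hN0 ‖average e‖ ‖disagreement e‖
  rw [inner_algorithmField, ← he, h3, norm_sq_eq_average_add_disagreement hN0 e]
  linarith

/-- The remaining graph may be unbalanced or disconnected, so only the norm bound is used, on the
whole error. -/
theorem two_mul_inner_algorithmField_le_of_attack (hN : 0 < N) {J : Fin N → Profile d → ℝ}
    {ε ι c : ℝ} (hι : 0 ≤ ι) (hc : 0 ≤ c) (hmono : StronglyMonotone ε (pseudoGrad J))
    (hlip : IsLipschitz ι (pseudoGrad J)) {G : Digraph (Fin N)} {xs : Profile d}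
    (hxs : pseudoGrad J xs = 0) (κ : ℝ) (a : Matrix (Fin N) (Fin N) ℝ) (A : DoSAttack N)
    (ψ : Fin N → Fin N → ℝ → ℤ) {t : ℝ} (ht : t ∈ A.active G)
    (hL : specNorm (laplacian (attackedWeights G ψ t)) ≤ c) (x : Estimates d) :
    2 * inner ℝ (x - stackedCopy xs) (algorithmField J κ a G A ψ t x) ≤
      growthRate N ε ι c * ‖x - stackedCopy xs‖ ^ 2 := by
  have h1 := le_inner_ownBlocks_extendedGrad hι hmono hlip hxs x
  set e := x - stackedCopy xs with he
  have h2 := mul_norm_sq_le_sum_inner (M := attackedWeights G ψ t) (α := -c) (S := univ)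
    (fun v _ => by
      have h := (abs_le.1 (abs_dotProduct_mulVec_le (laplacian (attackedWeights G ψ t)) v)).1
      have hv : 0 ≤ v ⬝ᵥ v := Finset.sum_nonneg fun i _ => mul_self_nonneg (v i)
      have := mul_le_mul_of_nonneg_right hL hv
      linarith) e (fun k l => mem_univ _)
  have h3 : effectiveWeights κ a G A ψ t = attackedWeights G ψ t := if_pos ht
  have h5 := le_growthRate_mul (ε := ε) (ι := ι) hN hc (norm_nonneg (average e))
    (norm_nonneg (disagreement e))
  rw [inner_algorithmField, ← he, h3]
  rw [norm_sq_eq_average_add_disagreement hN e] at h2 ⊢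
  linarith

/-- The squared error is controlled by the total time under attack. -/
theorem norm_sq_le_of_rates {f : ℝ → Estimates d → Estimates d} {t₀ la lb : ℝ} {S : Set ℝ}
    (hS : MeasurableSet S) {z : Estimates d}
    (hfree : ∀ t, t₀ ≤ t → t ∉ S → ∀ x, 2 * inner ℝ (x - z) (f t x) ≤ -la * ‖x - z‖ ^ 2)
    (hatt : ∀ t, t₀ ≤ t → t ∈ S → ∀ x, 2 * inner ℝ (x - z) (f t x) ≤ lb * ‖x - z‖ ^ 2)
    {x : ℝ → Estimates d} (hx : IsSolution f t₀ x) {t : ℝ} (ht : t₀ ≤ t) :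
    ‖x t - z‖ ^ 2 ≤ Real.exp (-la * (t - t₀) + (la + lb) * volume.real (S ∩ Ico t₀ t)) *
      ‖x t₀ - z‖ ^ 2 := by
  -- The rate is `-la` off `S` and `lb` on `S`.
  let g : ℝ → ℝ := fun s => -la + S.indicator (fun _ => la + lb) s
  have hind : IntervalIntegrable (S.indicator fun _ => la + lb) volume t₀ t := by
    have h : IntervalIntegrable (fun _ : ℝ => la + lb) volume t₀ t := intervalIntegrable_const
    exact ⟨h.1.indicator hS, h.2.indicator hS⟩
  have hgi : ∫ s in t₀..t, g s = -la * (t - t₀) + (la + lb) * volume.real (S ∩ Ico t₀ t) := by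
    rw [intervalIntegral.integral_add intervalIntegrable_const hind,
      intervalIntegral.integral_const, intervalIntegral.integral_of_le ht,
      ← integral_Ico_eq_integral_Ioc, integral_indicator hS, Measure.restrict_restrict hS,
      setIntegral_const]
    simp only [smul_eq_mul]
    ring
  rw [← hgi]
  refine norm_sq_le_exp_integral_mul (x := fun s => x s - z) (f := fun s => f s (x s)) ht
    (hx.2 t ht).1 (fun s hs => ?_) (intervalIntegrable_const.add hind) fun s hs => ?_
  · rw [(hx.2 s hs.1).2]
    abel
  · by_cases h : s ∈ S
    · simpa [g, h] using hatt s hs.1 h (x s)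
    · simpa [g, h] using hfree s hs.1 h (x s)

end ResilientNash

theorem theorem1 {N : ℕ} (hN : 2 ≤ N) (d : Fin N → ℕ)
    (J : Fin N → Profile d → ℝ) (hJ : CostAssumption J)
    (ε ι : ℝ) (hε : 0 < ε) (hι : 0 < ι)
    (hmono : StronglyMonotone ε (pseudoGrad J)) (hlip : IsLipschitz ι (pseudoGrad J))
    (G : Digraph (Fin N)) (hG : StronglyConnected G)
    (Abar : Matrix (Fin N) (Fin N) ℝ) (hAbar : IsAdjacencyMatrix G Abar)
    (ω : Fin N → ℝ) (hω : ∀ i, 0 < ω i)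
    (hωL : Matrix.vecMul ω (laplacian Abar) = 0)
    (κ : ℝ)
    (hκ : 1 / minPosEigenvalue (symPart (laplacian (scaledWeights ω Abar))) * (ι ^ 2 / ε + ι) < κ) :
    -- the Nash equilibrium exists and is unique
    ∃ xs : Profile d, IsNash J xs ∧ (∀ y, IsNash J y → y = xs) ∧
    ∃ la : ℝ, la = decayRate N ε ι κ
        (minPosEigenvalue (symPart (laplacian (scaledWeights ω Abar)))) ∧ 0 < la ∧
    ∀ c : ℝ, 0 ≤ c →
    ∃ lb : ℝ, lb = growthRate N ε ι c ∧ 0 < lb ∧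
    -- the conditions on the frequency and on the duration of the attacks
    ∀ μ ηs Tf Ta : ℝ, 1 < μ → 0 < ηs → ηs < la →
      2 * Real.log μ / ηs < Tf → (la + lb) / (la - ηs) < Ta →
    0 < la - (la + lb) / Ta - ηs ∧
    ∀ N₀ T₀ : ℝ, 0 < N₀ → 0 ≤ T₀ →
    ∃ ς : ℝ, 0 < ς ∧
    ∀ t₀ : ℝ, 0 ≤ t₀ →
    ∀ (A : DoSAttack N) (ψ : Fin N → Fin N → ℝ → ℤ), IsAttackFlag A G ψ →
      A.FrequencyBound G t₀ N₀ Tf → A.DurationBound G t₀ T₀ Ta →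
      (∀ t, t₀ ≤ t → t ∈ A.active G → specNorm (laplacian (attackedWeights G ψ t)) ≤ c) →
    -- the algorithm can be run from every initial value
    (∀ x₀ : Estimates d, ∃ x : ℝ → Estimates d,
      IsSolution (algorithmField J κ (scaledWeights ω Abar) G A ψ) t₀ x ∧ x t₀ = x₀) ∧
    -- and it converges exponentially to the Nash equilibrium
    (∀ x : ℝ → Estimates d,
      IsSolution (algorithmField J κ (scaledWeights ω Abar) G A ψ) t₀ x →
      ∀ t, t₀ ≤ t →
        ‖x t - stackedCopy xs‖ ^ 2 ≤
          ς * Real.exp (-(la - (la + lb) / Ta - ηs) * (t - t₀)) * ‖x t₀ - stackedCopy xs‖ ^ 2) := by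
  have hN0 : 0 < N := by omega
  obtain ⟨xs, hxs, huniq⟩ := exists_zero_of_stronglyMonotone hε hι hmono hlip
  obtain ⟨hl₂, -⟩ := minPosEigenvalue_laplacian hN hG hAbar hω hωL
  have hκ0 : 0 ≤ κ := le_trans (by positivity) hκ.le
  refine ⟨xs, (isNash_iff_pseudoGrad_eq_zero hJ xs).2 hxs,
    fun y hy => huniq y ((isNash_iff_pseudoGrad_eq_zero hJ y).1 hy), _, rfl,
    decayRate_pos hN0 hε hl₂ hκ, fun c hc => ⟨_, rfl, growthRate_pos hι hc, ?_⟩⟩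
  have hla := decayRate_pos hN0 hε hl₂ hκ
  have hlb := growthRate_pos (N := N) (ε := ε) hι hc
  have hfree := fun (A : DoSAttack N) ψ (t : ℝ) (ht : t ∉ A.active G) =>
    two_mul_inner_algorithmField_le_of_free hN hι.le hκ0 hmono hlip hG hAbar hω hωL hxs A ψ ht
  have hatt := fun (A : DoSAttack N) ψ (t : ℝ) (ht : t ∈ A.active G) hL =>
    two_mul_inner_algorithmField_le_of_attack hN0 hι.le hc hmono hlip hxs κ (scaledWeights ω Abar)
      A ψ ht hL
  generalize decayRate N ε ι κ
    (minPosEigenvalue (symPart (laplacian (scaledWeights ω Abar)))) = la at *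
  generalize growthRate N ε ι c = lb at *
  intro μ ηs Tf Ta _ hηs hηla _ hTa
  have hpos : 0 < la - ηs := sub_pos.2 hηla
  have hTa0 : 0 < Ta := lt_trans (by positivity) hTa
  -- The constant pays for the offset `T₀` in the duration bound.
  refine ⟨?_, fun N₀ T₀ _ hT₀ => ⟨Real.exp ((la + lb) * T₀), Real.exp_pos _, ?_⟩⟩
  · have : (la + lb) / Ta < la - ηs := by
      rw [div_lt_iff₀ hpos] at hTa
      rw [div_lt_iff₀ hTa0]
      linarith
    linarith
  intro t₀ _ A ψ hψ _ hdur hL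
  refine ⟨fun x₀ => exists_isSolution hι.le hlip κ _ G A hψ.measurable t₀ x₀, fun x hx t ht => ?_⟩
  refine (norm_sq_le_of_rates (measurableSet_active A G) (fun s _ h => hfree A ψ s h)
    (fun s hs h => hatt A ψ s h (hL s hs h)) hx ht).trans ?_
  refine mul_le_mul_of_nonneg_right ?_ (sq_nonneg _)
  rw [← Real.exp_add, Real.exp_le_exp]
  -- The duration bound speaks only of nondegenerate intervals.
  rcases ht.eq_or_lt with rfl | hlt
  · simp only [Set.Ico_self, Set.inter_empty, MeasureTheory.measureReal_empty, sub_self]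
    have : 0 ≤ (la + lb) * T₀ := by positivity
    linarith
  have h1 := mul_le_mul_of_nonneg_left (hdur t₀ t le_rfl hlt) (by positivity : 0 ≤ la + lb)
  -- The estimate holds even without `ηs` in the rate; this slack is given away.
  have h2 : 0 ≤ ηs * (t - t₀) := mul_nonneg hηs.le (sub_nonneg.2 ht)
  have h3 : (la + lb) * (T₀ + (t - t₀) / Ta) =
      (la + lb) * T₀ + (la + lb) / Ta * (t - t₀) := by ring
  linarith
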